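/- **Setting.** Let $\Omega=(l_1,l_2)\times(l_3,l_4)$, let $\psi$ be smooth, $\Gamma_I=\{z\in\Omega:\psi(z)=0\}$, $\Omega^{\pm}=\{z\in\Omega:\pm\psi(z)>0\}$, $\Gamma_3=(l_1,l_2)\times\{l_3\}$. Let $(x_0,l_3)\in\Gamma_3$ be a point outside $\overline{\Gamma_I}$. Let the coefficient $a$ be positive and six times continuously differentiable on $\overline\Omega\setminus\overline{\Gamma_I}$, with partial derivatives of order up to six uniformly continuous in $\Omega^+$ and in $\Omega^-$. An *exact solution* is a triple $(u,f,g)$ with $u\in C^7(\overline\Omega\setminus\overline{\Gamma_I})$ whose partial derivatives of order up to seven are uniformly continuous in $\Omega^{\pm}$, $f\in C^5(\overline\Omega\setminus\overline{\Gamma_I})$, $g$ with uniformly continuous derivatives of order up to five on $(l_1,l_2)$, $-\nabla\cdot(a\nabla u)=f$ in $\Omega\setminus\Gamma_I$, and $\frac{\partial u}{\partial\vec n}=-u_y=g$ on $\Gamma_3\setminus\overline{\Gamma_I}$. The interface jumps of $u$ and of the flux, and the data on the other three sides, are arbitrary. Write $v^{(m,n)}=\partial_x^m\partial_y^n v(x_0,l_3)$,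 $g^{(n)}=g^{(n)}(x_0)$, $\Lambda_K=\{(m,n)\in\mathbb N_0^2:m+n\le K\}$, $\Lambda^{H,2}_K=\{(m,n)\in\Lambda_K:n\ge2\}$. Repeated differentiation of the equation $u_{yy}=-u_{xx}-\frac{a_x}{a}u_x-\frac{a_y}{a}u_y-\frac1af$ at $(x_0,l_3)$ gives $u^{(m',n')}=\sum_{m,\;n\in\{0,1\}}A^{u}_{m',n',m,n}u^{(m,n)}+\sum_{m,n}A^{f}_{m',n',m,n}f^{(m,n)}$ with constants $A^u,A^f$ determined by the partial derivatives of $a$ at $(x_0,l_3)$. Put $$G_{m,n}(x,y)=\sum_{\ell=0}^{\lfloor m/2\rfloor}\frac{(-1)^\ell y^{n+2\ell}x^{m-2\ell}}{(n+2\ell)!(m-2\ell)!}+\sum_{(m',n')\in\Lambda^{H,2}_6\setminus\Lambda^{H,2}_{m+n}}A^u_{m',n',m,n}\frac{x^{m'}y^{n'}}{m'!n'!}\quad(n\in\{0,1\},\ m+n\le 6),$$ $$Q_{m,n}(x,y)=\sum_{\ell=1}^{1+\lfloor m/2\rfloor}\frac{(-1)^\ell y^{n+2\ell}x^{m-2\ell+2}}{(n+2\ell)!(m-2\ell+2)!}\frac1{a^{(0,0)}}+\sum_{(m',n')\in\Lambda^{H,2}_6\setminus\Lambda^{H,2}_{m+n+2}}A^f_{m',n',m,n}\frac{x^{m'}y^{n'}}{m'!n'!}\quad((m,n)\in\Lambda_4).$$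 A *six-point scheme* at $(x_0,l_3)$ with data $(N,K)$ is an equation $$\sum_{k=-1}^1\sum_{\ell=0}^1C_{k,\ell}(h)\,u(x_0+kh,l_3+\ell h)=\sum_{(m,n)\in\Lambda_N}f^{(m,n)}C_{f,m,n}(h)+\sum_{n=0}^Kg^{(n)}C_{g,n}(h);$$ it is *nontrivial* if the $C_{k,\ell}(h)$ do not all tend to $0$ as $h\to0^+$. It has *order* $p$ if for every exact solution the difference of the two sides is $O(h^{p+1})$ as $h\to0^+$ (the left side is scaled like $h\,\partial u/\partial\vec n$). **Theorem.** 1. Let $c=(c_{k,\ell,i})_{k\in\{-1,0,1\},\ell\in\{0,1\},0\le i\le6}$ be real numbers, not all zero, such that $C_{k,\ell}(h)=\sum_{i=0}^6c_{k,\ell,i}h^i$ satisfy $$\sum_{k=-1}^1\sum_{\ell=0}^1C_{k,\ell}(h)\,G_{n,0}(kh,\ell h)=O(h^7)\quad(h\to0^+),\qquad n=0,1,\dots,6.\tag{$*$}$$ Then the six-point scheme with these $C_{k,\ell}$, with $C_{f,m,n}=\sum_{k,\ell}C_{k,\ell}Q_{m,n}(kh,\ell h)$ for $(m,n)\in\Lambda_4$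 and $C_{g,n}=-\sum_{k,\ell}C_{k,\ell}G_{n,1}(kh,\ell h)$ for $0\le n\le5$, has order six. 2. The system $(*)$ has solutions for which the $c_{k,\ell,0}$ are not all zero. 3. The largest order of a nontrivial six-point scheme with data $(N,K)=(4,5)$ is six. 4. If $a$ is smooth (it satisfies the regularity assumption for all orders) and $a_y(x_0,l_3)\neq0$, then for all $N,K$ no nontrivial six-point scheme with data $(N,K)$ has an order greater than six, even if order is tested only on exact solutions $(u,f,g)$ that are smooth (regularity of all orders). -/

import Mathlib

open Set Filter Topology Asymptotics
open scoped ContDiff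

noncomputable section

/-- A rectangle `(l₁, l₂) × (l₃, l₄)` together with a smooth level-set function `ψ`. -/
structure InterfaceDomain where
  l₁ : ℝ
  l₂ : ℝ
  l₃ : ℝ
  l₄ : ℝ
  lt₁₂ : l₁ < l₂
  lt₃₄ : l₃ < l₄
  ψ : ℝ × ℝ → ℝ
  smooth_ψ : ContDiff ℝ ∞ ψ

/-! ### Partial derivatives relative to a set

At an interior point of `S` these are the ordinary partial derivatives; at a boundary point of a
set of unique differentiability they are the derivatives from inside `S`. -/

/-- `∂v/∂x` relative to `S`. -/
def partialX (S : Set (ℝ × ℝ)) (v : ℝ × ℝ → ℝ) : ℝ × ℝ → ℝ :=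
  fun z => fderivWithin ℝ v S z (1, 0)

/-- `∂v/∂y` relative to `S`. -/
def partialY (S : Set (ℝ × ℝ)) (v : ℝ × ℝ → ℝ) : ℝ × ℝ → ℝ :=
  fun z => fderivWithin ℝ v S z (0, 1)

/-- `∂^{m+n} v / ∂x^m ∂y^n` relative to `S`. -/
def partialD (S : Set (ℝ × ℝ)) (m n : ℕ) (v : ℝ × ℝ → ℝ) : ℝ × ℝ → ℝ :=
  (partialX S)^[m] ((partialY S)^[n] v)

namespace InterfaceDomain

variable (D : InterfaceDomain)

/-- The open rectangle. -/
def Ω : Set (ℝ × ℝ) := Ioo D.l₁ D.l₂ ×ˢ Ioo D.l₃ D.l₄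

/-- The interface curve. -/
def interface : Set (ℝ × ℝ) := {z ∈ D.Ω | D.ψ z = 0}

/-- The subregion where the level-set function is positive. -/
def Ωpos : Set (ℝ × ℝ) := {z ∈ D.Ω | 0 < D.ψ z}

/-- The subregion where the level-set function is negative. -/
def Ωneg : Set (ℝ × ℝ) := {z ∈ D.Ω | D.ψ z < 0}

/-- The closed rectangle without the closure of the interface: the two open subregions together
with the part of the outer boundary that the interface does not touch. -/
def region : Set (ℝ × ℝ) := (Icc D.l₁ D.l₂ ×ˢ Icc D.l₃ D.l₄) \ closure D.interface

/-- `v` is of class `C^k` off the interface (up to the outer boundary), and its partial derivatives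
of total order at most `k` are uniformly continuous in each of the two subregions. -/
structure PiecewiseSmooth (k : ℕ∞) (v : ℝ × ℝ → ℝ) : Prop where
  contDiffOn : ContDiffOn ℝ k v D.region
  unif_pos : ∀ i j : ℕ, ((i + j : ℕ) : ℕ∞) ≤ k → UniformContinuousOn (partialD D.region i j v) D.Ωpos
  unif_neg : ∀ i j : ℕ, ((i + j : ℕ) : ℕ∞) ≤ k → UniformContinuousOn (partialD D.region i j v) D.Ωneg

/-- `u` is an exact solution of the interface problem with source `f` and Neumann data `g` on the
bottom side `(l₁, l₂) × {l₃}`, at regularity level `k`: `u` has `k + 2` derivatives, `f` and `g`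
have `k`. The data on the interface (the jumps of `u` and of the flux) and on the other three
sides are free data of the problem; they are those produced by `u` and are not named.
Uniform continuity of the derivatives of `f` follows from the equation. -/
structure IsSolution (k : ℕ∞) (a u f : ℝ × ℝ → ℝ) (g : ℝ → ℝ) : Prop where
  smooth_u : D.PiecewiseSmooth (k + 2) u
  smooth_f : ContDiffOn ℝ k f D.region
  smooth_g : ContDiffOn ℝ k g (Ioo D.l₁ D.l₂)
  unif_g : ∀ j : ℕ, (j : ℕ∞) ≤ k → UniformContinuousOn (iteratedDeriv j g) (Ioo D.l₁ D.l₂)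
  /-- `-∇ · (a ∇u) = f` off the interface. -/
  pde : ∀ z ∈ D.Ω \ D.interface,
    -(partialX D.region (fun w => a w * partialX D.region u w) z
      + partialY D.region (fun w => a w * partialY D.region u w) z) = f z
  /-- `∂u/∂n = g` on the bottom side; the outward unit normal there is `(0, -1)`. -/
  neumann : ∀ x ∈ Ioo D.l₁ D.l₂, (x, D.l₃) ∉ closure D.interface →
    fderivWithin ℝ u D.region (x, D.l₃) (0, -1) = g x

end InterfaceDomain

/-! ### The polynomials `G^H` and `Q^H` -/

/-- Pairs of nonnegative integers of sum at most `K`. -/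
def Lam (K : ℕ) : Finset (ℕ × ℕ) :=
  (Finset.range (K + 1) ×ˢ Finset.range (K + 1)).filter fun p => p.1 + p.2 ≤ K

/-- The pairs in `Lam K` with second entry at least two. -/
def LamH2 (K : ℕ) : Finset (ℕ × ℕ) := (Lam K).filter fun p => 2 ≤ p.2

/-- The partial derivatives `u^{(m,n)}` (argument order: `n`, then `m`) at a point which the
equation forces, through its own partial derivatives, from `u^{(m,0)} = d (m,0)`,
`u^{(m,1)} = d (m,1)` and `f^{(m,n)} = F (m,n)`. The equation is written as
`u_yy = -u_xx - p u_x - q u_y - s f` with `p = a_x / a`, `q = a_y / a`, `s = 1 / a`, and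
`p i j`, `q i j`, `s i j` stand for the `(i,j)`-th partial derivatives of these at the point. -/
def forcedJet (p q s : ℕ → ℕ → ℝ) (d F : ℕ × ℕ → ℝ) : ℕ → ℕ → ℝ
  | 0, m => d (m, 0)
  | 1, m => d (m, 1)
  | n + 2, m =>
      -forcedJet p q s d F n (m + 2)
        - ∑ i ∈ Finset.range (m + 1), ∑ j ∈ Finset.range (n + 1),
            (m.choose i : ℝ) * (n.choose j : ℝ) *
              (p i j * forcedJet p q s d F (n - j) (m - i + 1)
                + q i j * forcedJet p q s d F (n - j + 1) (m - i)
                + s i j * F (m - i, n - j))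
  termination_by n => n
  decreasing_by all_goals omega

section Polynomials

/- `S` is the set relative to which derivatives are taken, `z₀` the base point. -/
variable (S : Set (ℝ × ℝ)) (a : ℝ × ℝ → ℝ) (z₀ : ℝ × ℝ)

/-- `forcedJet` for the coefficient `a` at the base point `z₀`. -/
def coeffJet (d F : ℕ × ℕ → ℝ) (m n : ℕ) : ℝ :=
  forcedJet (fun i j => partialD S i j (fun z => partialX S a z / a z) z₀)
    (fun i j => partialD S i j (fun z => partialY S a z / a z) z₀)
    (fun i j => partialD S i j (fun z => 1 / a z) z₀) d F n m

/-- `A^{H,u}_{m',n',m,n}`: the coefficient of `u^{(m,n)}` (`n ≤ 1`) in `u^{(m',n')}`. -/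
def AHu (m' n' m n : ℕ) : ℝ := coeffJet S a z₀ (Pi.single (m, n) 1) 0 m' n'

/-- `A^{H,f}_{m',n',m,n}`: the coefficient of `f^{(m,n)}` in `u^{(m',n')}`. -/
def AHf (m' n' m n : ℕ) : ℝ := coeffJet S a z₀ 0 (Pi.single (m, n) 1) m' n'

/-- `G^H_{M,m,n}(x,y)`, for `n ≤ 1` and `m + n ≤ M + 1`. -/
def GH (M m n : ℕ) (x y : ℝ) : ℝ :=
  ∑ l ∈ Finset.range (m / 2 + 1),
      (-1) ^ l * y ^ (n + 2 * l) * x ^ (m - 2 * l)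
        / (((n + 2 * l).factorial : ℝ) * ((m - 2 * l).factorial : ℝ))
    + ∑ r ∈ LamH2 (M + 1) \ LamH2 (m + n),
      AHu S a z₀ r.1 r.2 m n * (x ^ r.1 * y ^ r.2 / ((r.1.factorial : ℝ) * (r.2.factorial : ℝ)))

/-- `Q^H_{M,m,n}(x,y)`, for `m + n ≤ M - 1`. -/
def QH (M m n : ℕ) (x y : ℝ) : ℝ :=
  ∑ l ∈ Finset.Icc 1 (1 + m / 2),
      (-1) ^ l * y ^ (n + 2 * l) * x ^ (m + 2 - 2 * l)
        / (((n + 2 * l).factorial : ℝ) * ((m + 2 - 2 * l).factorial : ℝ)) * (1 / a z₀)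
    + ∑ r ∈ LamH2 (M + 1) \ LamH2 (m + n + 2),
      AHf S a z₀ r.1 r.2 m n * (x ^ r.1 * y ^ r.2 / ((r.1.factorial : ℝ) * (r.2.factorial : ℝ)))

end Polynomials

/-! ### Six-point schemes -/

/-- Indices of the six stencil points: `(i, j)` stands for `k = i - 1 ∈ {-1, 0, 1}` and
`ℓ = j ∈ {0, 1}`. -/
abbrev Stencil : Type := Fin 3 × Fin 2

/-- The integer `k ∈ {-1, 0, 1}` of a stencil index, as a real number. -/
def Stencil.k (s : Stencil) : ℝ := ((s.1 : ℕ) : ℝ) - 1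

/-- The integer `ℓ ∈ {0, 1}` of a stencil index, as a real number. -/
def Stencil.l (s : Stencil) : ℝ := ((s.2 : ℕ) : ℝ)

/-- A six-point scheme
`∑ C_{k,ℓ}(h) u_{k,ℓ} = ∑ f^{(m,n)} C_{f,m,n}(h) + ∑ g^{(n)} C_{g,n}(h)`,
where all coefficients may depend on the mesh size `h`. -/
structure SixPointScheme where
  C : Stencil → ℝ → ℝ
  Cf : ℕ × ℕ → ℝ → ℝ
  Cg : ℕ → ℝ → ℝ

namespace SixPointScheme

/-- The coefficients of the unknowns do not all tend to zero as `h → 0⁺`. (This normalization is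
needed to speak of an order: multiplying a scheme by a power of `h` must not change it.) -/
def Nontrivial (σ : SixPointScheme) : Prop :=
  ¬ Tendsto (fun h s => σ.C s h) (𝓝[>] (0 : ℝ)) (𝓝 (0 : Stencil → ℝ))

/-- Left-hand side minus right-hand side at the bottom side point `(x₀, l₃)` for mesh size `h`,
with the exact solution `u` inserted. The right-hand side uses the partial derivatives of `f` of
order at most `N` and the derivatives of `g` of order at most `K`. -/
def residual (σ : SixPointScheme) (D : InterfaceDomain) (x₀ : ℝ) (N K : ℕ)
    (u f : ℝ × ℝ → ℝ) (g : ℝ → ℝ) (h : ℝ) : ℝ :=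
  ∑ s : Stencil, σ.C s h * u (x₀ + s.k * h, D.l₃ + s.l * h)
    - (∑ r ∈ Lam N, partialD D.region r.1 r.2 f (x₀, D.l₃) * σ.Cf r h
      + ∑ n ∈ Finset.range (K + 1), iteratedDeriv n g x₀ * σ.Cg n h)

/-- Accuracy of order `p` for `∂u/∂n = g` at `(x₀, l₃)`: the residual of every exact solution is
`O(h^{p+1})`. The extra power of `h` is the scaling of the scheme: with coefficients of size one,
the left-hand side is of the size of `h ∂u/∂n`. -/
def HasOrder (σ : SixPointScheme) (D : InterfaceDomain) (a : ℝ × ℝ → ℝ) (x₀ : ℝ) (k : ℕ∞)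
    (N K p : ℕ) : Prop :=
  ∀ (u f : ℝ × ℝ → ℝ) (g : ℝ → ℝ), D.IsSolution k a u f g →
    (fun h => σ.residual D x₀ N K u f g h) =O[𝓝[>] (0 : ℝ)] fun h => h ^ (p + 1)

end SixPointScheme

/-- `C_{k,ℓ}(h) = ∑_{i ≤ 6} c_{k,ℓ,i} h^i`. -/
def stencilCoeff (c : Stencil → Fin 7 → ℝ) (s : Stencil) (h : ℝ) : ℝ :=
  ∑ i : Fin 7, c s i * h ^ (i : ℕ)

/-- The linear system for the numbers `c_{k,ℓ,i}`:
`∑ C_{k,ℓ}(h) G^H_{5,n,0}(kh, ℓh) = O(h^7)` as `h → 0⁺`, for `n = 0, …, 6`. -/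
def SolvesNeumannSystem (D : InterfaceDomain) (a : ℝ × ℝ → ℝ) (x₀ : ℝ)
    (c : Stencil → Fin 7 → ℝ) : Prop :=
  ∀ n ≤ 6, (fun h : ℝ => ∑ s : Stencil,
      stencilCoeff c s h * GH D.region a (x₀, D.l₃) 5 n 0 (s.k * h) (s.l * h))
    =O[𝓝[>] (0 : ℝ)] fun h => h ^ 7

/-- The scheme built from the numbers `c_{k,ℓ,i}`. -/
def neumannScheme (D : InterfaceDomain) (a : ℝ × ℝ → ℝ) (x₀ : ℝ)
    (c : Stencil → Fin 7 → ℝ) : SixPointScheme where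
  C := stencilCoeff c
  Cf r h := ∑ s : Stencil,
    stencilCoeff c s h * QH D.region a (x₀, D.l₃) 5 r.1 r.2 (s.k * h) (s.l * h)
  Cg n h := -∑ s : Stencil,
    stencilCoeff c s h * GH D.region a (x₀, D.l₃) 5 n 1 (s.k * h) (s.l * h)

end

/-!
At `(x₀, l₃)` the equation determines all derivatives of `u` from `u^{(m,0)}`,
`u^{(m,1)} = -g^{(m)}` and those of `f`, and `G`, `Q` are the Taylor polynomials that collect the
contributions of each of these free derivatives. Hence the system `(*)` makes the residual
`O(h ^ 7)`.

Ordered by powers of `h`, the system asks at each level for a coefficient vector on the stencil with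
prescribed pairings against the harmonic polynomials `Re (x + iy) ^ n / n!`, the leading parts of
the `G_{n,0}`. On the six points those with `n ≤ 4` are independent, those with `n = 5, 6` depend on
them, and a discrete Laplacian is orthogonal to all of them. Starting from that Laplacian, the only
compatibility condition arises at the first level, where it concerns the first-order correction to
the harmonic polynomials, and it is satisfied.

Conversely, in a scheme of order seven the limits of the coefficients could only be a multiple of
the same Laplacian. This multiple vanishes, because the Laplacian has a nonzero pairing with one
more exact solution: with `y ^ 7`, whose data a scheme with data `(4, 5)` does not see, or with the
first-order part of `720 G_{6,0} - 2 G_{2,0}`, where the pairing is a nonzero multiple of `a_y / a`.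
-/

noncomputable section

/-! ### Directional derivatives relative to a set -/

section DirectionalDerivatives

variable {E : Type*} [NormedAddCommGroup E] [NormedSpace ℝ E]

/-- The derivative of `v` in direction `e` relative to `S`; `partialX` and `partialY` are the cases
`e = (1, 0)` and `e = (0, 1)` in the plane. -/
def dirD (S : Set E) (e : E) (v : E → ℝ) : E → ℝ :=
  fun z => fderivWithin ℝ v S z e

variable {S : Set E} {e : E} {v w : E → ℝ}

lemma dirD_congr (h : EqOn v w S) : EqOn (dirD S e v) (dirD S e w) S := fun z hz => by
  simp only [dirD, fderivWithin_congr h (h hz)]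

lemma dirD_iterate_congr (m : ℕ) (h : EqOn v w S) :
    EqOn ((dirD S e)^[m] v) ((dirD S e)^[m] w) S := by
  induction m generalizing v w with
  | zero => exact h
  | succ _ ih => exact ih (dirD_congr h)

lemma contDiffOn_dirD (hS : UniqueDiffOn ℝ S) {n : ℕ} (h : ContDiffOn ℝ (n + 1 : ℕ) v S) :
    ContDiffOn ℝ n (dirD S e v) S :=
  (h.fderivWithin hS (by norm_cast)).clm_apply contDiffOn_const

lemma contDiffOn_dirD_iterate (hS : UniqueDiffOn ℝ S) {n : ℕ} (m : ℕ)
    (h : ContDiffOn ℝ (n + m : ℕ) v S) : ContDiffOn ℝ n ((dirD S e)^[m] v) S := by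
  induction m generalizing v with
  | zero => exact h
  | succ m ih => exact ih (contDiffOn_dirD hS h)

lemma dirD_sum (hS : UniqueDiffOn ℝ S) {ι : Type*} (s : Finset ι) (b : ι → ℝ) (V : ι → E → ℝ)
    (hV : ∀ i ∈ s, DifferentiableOn ℝ (V i) S) :
    EqOn (dirD S e fun z => ∑ i ∈ s, b i * V i z) (fun z => ∑ i ∈ s, b i * dirD S e (V i) z) S := by
  intro z hz
  simp only [dirD]
  rw [fderivWithin_fun_sum (hS z hz) fun i hi => (hV i hi z hz).const_mul (b i), sum_apply]
  exact Finset.sum_congr rfl fun i hi => by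
    rw [fderivWithin_const_mul (hS z hz) (hV i hi z hz), smul_apply, smul_eq_mul]

lemma dirD_mul (hS : UniqueDiffOn ℝ S) (hv : DifferentiableOn ℝ v S)
    (hw : DifferentiableOn ℝ w S) :
    EqOn (dirD S e fun z => v z * w z) (fun z => v z * dirD S e w z + dirD S e v z * w z) S :=
  fun z hz => by
    simp only [dirD]
    rw [fderivWithin_fun_mul (hS z hz) (hv z hz) (hw z hz)]
    simp [mul_comm]

lemma dirD_iterate_sum (hS : UniqueDiffOn ℝ S) (m : ℕ) {ι : Type*} (s : Finset ι)
    (b : ι → ℝ) (V : ι → E → ℝ) (hV : ∀ i ∈ s, ContDiffOn ℝ m (V i) S) :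
    EqOn ((dirD S e)^[m] fun z => ∑ i ∈ s, b i * V i z)
      (fun z => ∑ i ∈ s, b i * (dirD S e)^[m] (V i) z) S := by
  induction m generalizing V with
  | zero => exact fun z _ => rfl
  | succ m ih =>
    exact (dirD_iterate_congr m
      (dirD_sum hS s b V fun i hi => (hV i hi).differentiableOn (by norm_cast))).trans
        (ih _ fun i hi => contDiffOn_dirD hS (hV i hi))

lemma dirD_iterate_add (hS : UniqueDiffOn ℝ S) (m : ℕ) (hv : ContDiffOn ℝ m v S)
    (hw : ContDiffOn ℝ m w S) :
    EqOn ((dirD S e)^[m] fun z => v z + w z)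
      (fun z => (dirD S e)^[m] v z + (dirD S e)^[m] w z) S := by
  simpa using dirD_iterate_sum (e := e) hS m Finset.univ 1 ![v, w]
    (by simpa [Fin.forall_fin_two] using ⟨hv, hw⟩)

lemma dirD_iterate_mul (hS : UniqueDiffOn ℝ S) (m : ℕ) (hv : ContDiffOn ℝ m v S)
    (hw : ContDiffOn ℝ m w S) :
    EqOn ((dirD S e)^[m] fun z => v z * w z)
      (fun z => ∑ i ∈ Finset.range (m + 1),
        (m.choose i : ℝ) * ((dirD S e)^[i] v z * (dirD S e)^[m - i] w z)) S := by
  induction m generalizing v w with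
  | zero => intro z _; simp
  | succ m ih =>
    intro z hz
    have hv' : ContDiffOn ℝ m v S := hv.of_le (by norm_cast; omega)
    have hw' : ContDiffOn ℝ m w S := hw.of_le (by norm_cast; omega)
    have hdv := contDiffOn_dirD (e := e) hS hv
    have hdw := contDiffOn_dirD (e := e) hS hw
    have hvw := dirD_mul (e := e) hS (hv.differentiableOn (by norm_cast))
      (hw.differentiableOn (by norm_cast))
    rw [Function.iterate_succ_apply, dirD_iterate_congr m hvw hz,
      dirD_iterate_add hS m (hv'.mul hdw) (hdv.mul hw') hz]
    simp only
    rw [ih hv' hdw hz, ih hdv hw' hz,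
      Finset.sum_choose_succ_mul fun i j => (dirD S e)^[i] v z * (dirD S e)^[j] w z]
    congr 1
    refine Finset.sum_congr rfl fun i hi => ?_
    rw [← Function.iterate_succ_apply, Nat.succ_eq_add_one,
      Nat.sub_add_comm (Nat.lt_succ_iff.mp (Finset.mem_range.mp hi))]

lemma dirD_comm (hS : UniqueDiffOn ℝ S) (hcl : S ⊆ closure (interior S)) (e e' : E)
    (hv : ContDiffOn ℝ 2 v S) :
    EqOn (dirD S e (dirD S e' v)) (dirD S e' (dirD S e v)) S := fun z hz => by
  have hd : DifferentiableWithinAt ℝ (fderivWithin ℝ v S) S z :=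
    (hv.fderivWithin hS (m := 1) (by norm_num)).differentiableOn one_ne_zero z hz
  have dirD_dirD (c d : E) : dirD S c (dirD S d v) z
      = fderivWithin ℝ (fderivWithin ℝ v S) S z c d := by
    change fderivWithin ℝ (fun y => fderivWithin ℝ v S y d) S z c = _
    rw [fderivWithin_clm_apply (hS z hz) hd (differentiableWithinAt_const d)]
    simp
  rw [dirD_dirD, dirD_dirD]
  exact ((hv z hz).isSymmSndFDerivWithinAt (by simp) hS (hcl hz) hz).eq _ _

lemma dirD_iterate_comm (hS : UniqueDiffOn ℝ S) (hcl : S ⊆ closure (interior S)) (e e' : E)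
    (m : ℕ) (hv : ContDiffOn ℝ (m + 1 : ℕ) v S) :
    EqOn ((dirD S e)^[m] (dirD S e' v)) (dirD S e' ((dirD S e)^[m] v)) S := by
  induction m generalizing v with
  | zero => exact fun z _ => rfl
  | succ m ih =>
    exact (dirD_iterate_congr m (dirD_comm hS hcl e e' (hv.of_le (by norm_cast; omega)))).trans
      (ih (contDiffOn_dirD hS hv))

end DirectionalDerivatives

/-! ### Partial derivatives relative to a set -/

section PartialDerivatives

variable {S : Set (ℝ × ℝ)} {v w : ℝ × ℝ → ℝ}

lemma dirD_eq_partialX_partialY (e : ℝ × ℝ) (z : ℝ × ℝ) :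
    dirD S e v z = e.1 * partialX S v z + e.2 * partialY S v z := by
  rw [dirD, partialX, partialY, ← smul_eq_mul, ← smul_eq_mul, ← map_smul, ← map_smul, ← map_add]
  simp

lemma partialD_succ_right (m n : ℕ) : partialD S m (n + 1) v = partialD S m n (partialY S v) := rfl

lemma partialD_succ_left (m n : ℕ) : partialD S (m + 1) n v = partialX S (partialD S m n v) :=
  Function.iterate_succ_apply' ..

lemma partialD_congr (m n : ℕ) (h : EqOn v w S) : EqOn (partialD S m n v) (partialD S m n w) S :=
  dirD_iterate_congr m (dirD_iterate_congr n h)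

lemma contDiffOn_partialX (hS : UniqueDiffOn ℝ S) {n : ℕ} (h : ContDiffOn ℝ (n + 1 : ℕ) v S) :
    ContDiffOn ℝ n (partialX S v) S := contDiffOn_dirD hS h

lemma contDiffOn_partialY (hS : UniqueDiffOn ℝ S) {n : ℕ} (h : ContDiffOn ℝ (n + 1 : ℕ) v S) :
    ContDiffOn ℝ n (partialY S v) S := contDiffOn_dirD hS h

lemma contDiffOn_partialD (hS : UniqueDiffOn ℝ S) {l : ℕ} (m n : ℕ)
    (h : ContDiffOn ℝ (l + m + n : ℕ) v S) : ContDiffOn ℝ l (partialD S m n v) S :=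
  contDiffOn_dirD_iterate hS m (contDiffOn_dirD_iterate hS n h)

lemma partialD_sum (hS : UniqueDiffOn ℝ S) (m n : ℕ) {ι : Type*} (s : Finset ι) (b : ι → ℝ)
    (V : ι → ℝ × ℝ → ℝ) (hV : ∀ i ∈ s, ContDiffOn ℝ (m + n : ℕ) (V i) S) :
    EqOn (partialD S m n fun z => ∑ i ∈ s, b i * V i z)
      (fun z => ∑ i ∈ s, b i * partialD S m n (V i) z) S :=
  (dirD_iterate_congr m (dirD_iterate_sum hS n s b V fun i hi =>
    (hV i hi).of_le (by norm_cast; omega))).trans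
      (dirD_iterate_sum hS m s b _ fun i hi => contDiffOn_dirD_iterate hS n (hV i hi))

lemma partialD_add (hS : UniqueDiffOn ℝ S) (m n : ℕ) (hv : ContDiffOn ℝ (m + n : ℕ) v S)
    (hw : ContDiffOn ℝ (m + n : ℕ) w S) :
    EqOn (partialD S m n fun z => v z + w z) (fun z => partialD S m n v z + partialD S m n w z)
      S := by
  simpa using partialD_sum hS m n Finset.univ 1 ![v, w]
    (by simpa [Fin.forall_fin_two] using ⟨hv, hw⟩)

lemma partialD_neg (hS : UniqueDiffOn ℝ S) (m n : ℕ) (hv : ContDiffOn ℝ (m + n : ℕ) v S) :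
    EqOn (partialD S m n fun z => -v z) (fun z => -partialD S m n v z) S := by
  simpa using partialD_sum hS m n Finset.univ (fun _ : Unit => -1) (fun _ => v) (by simpa using hv)

lemma partialD_mul (hS : UniqueDiffOn ℝ S) (m n : ℕ) (hv : ContDiffOn ℝ (m + n : ℕ) v S)
    (hw : ContDiffOn ℝ (m + n : ℕ) w S) :
    EqOn (partialD S m n fun z => v z * w z)
      (fun z => ∑ i ∈ Finset.range (m + 1), ∑ j ∈ Finset.range (n + 1),
        (m.choose i : ℝ) * (n.choose j : ℝ) *
          (partialD S i j v z * partialD S (m - i) (n - j) w z)) S := by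
  intro z hz
  have hiter {t : ℝ × ℝ → ℝ} (ht : ContDiffOn ℝ (m + n : ℕ) t S) {j : ℕ} (hj : j ≤ n) :
      ContDiffOn ℝ m ((partialY S)^[j] t) S :=
    contDiffOn_dirD_iterate hS j (ht.of_le (by norm_cast; omega))
  have hle {j : ℕ} (hj : j ∈ Finset.range (n + 1)) : j ≤ n := Finset.mem_range_succ_iff.mp hj
  have hY : EqOn ((partialY S)^[n] fun z => v z * w z) (fun z => ∑ j ∈ Finset.range (n + 1),
      (n.choose j : ℝ) * ((partialY S)^[j] v z * (partialY S)^[n - j] w z)) S :=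
    dirD_iterate_mul hS n (hv.of_le (by norm_cast; omega)) (hw.of_le (by norm_cast; omega))
  have hX := dirD_iterate_sum (e := (1, 0)) hS m (Finset.range (n + 1)) (fun j => (n.choose j : ℝ))
    (fun j z => (partialY S)^[j] v z * (partialY S)^[n - j] w z) fun j hj =>
      (hiter hv (hle hj)).mul (hiter hw (Nat.sub_le n j))
  refine ((dirD_iterate_congr m hY hz).trans (hX hz)).trans ?_
  simp only
  rw [Finset.sum_comm]
  refine Finset.sum_congr rfl fun j hj => ?_
  rw [dirD_iterate_mul hS m (hiter hv (hle hj)) (hiter hw (Nat.sub_le n j)) hz, Finset.mul_sum]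
  exact Finset.sum_congr rfl fun i _ => by rw [mul_left_comm, ← mul_assoc]; rfl

lemma partialD_partialX (hS : UniqueDiffOn ℝ S) (hcl : S ⊆ closure (interior S)) (m n : ℕ)
    (hv : ContDiffOn ℝ (m + n + 1 : ℕ) v S) :
    EqOn (partialD S m n (partialX S v)) (partialD S (m + 1) n v) S :=
  dirD_iterate_congr m (dirD_iterate_comm hS hcl (0, 1) (1, 0) n
    (hv.of_le (by norm_cast; omega)))

end PartialDerivatives

/-! ### Algebra of forced jets -/

lemma mem_Lam {N : ℕ} {r : ℕ × ℕ} : r ∈ Lam N ↔ r.1 + r.2 ≤ N := by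
  simp only [Lam, Finset.mem_filter, Finset.mem_product, Finset.mem_range]; omega

lemma mem_LamH2 {N : ℕ} {r : ℕ × ℕ} : r ∈ LamH2 N ↔ r.1 + r.2 ≤ N ∧ 2 ≤ r.2 := by
  simp only [LamH2, Finset.mem_filter, mem_Lam]

section ForcedJet

variable (p q s : ℕ → ℕ → ℝ)

/-- The Leibniz expansion of `∂_x^m ∂_y^n (p u_x + q u_y + s f)` at a point, in terms of the
jets `J i j = u^{(i,j)}` and `F (i, j) = f^{(i,j)}`. -/
def lowerOrderJet (J : ℕ → ℕ → ℝ) (F : ℕ × ℕ → ℝ) (m n : ℕ) : ℝ :=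
  ∑ i ∈ Finset.range (m + 1), ∑ j ∈ Finset.range (n + 1),
    (m.choose i : ℝ) * (n.choose j : ℝ) *
      (p i j * J (m - i + 1) (n - j) + q i j * J (m - i) (n - j + 1) + s i j * F (m - i, n - j))

lemma forcedJet_zero (d F : ℕ × ℕ → ℝ) (m : ℕ) : forcedJet p q s d F 0 m = d (m, 0) := by
  rw [forcedJet]

lemma forcedJet_one (d F : ℕ × ℕ → ℝ) (m : ℕ) : forcedJet p q s d F 1 m = d (m, 1) := by
  rw [forcedJet]

lemma forcedJet_of_le_one (d F : ℕ × ℕ → ℝ) (m : ℕ) {n : ℕ} (hn : n ≤ 1) :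
    forcedJet p q s d F n m = d (m, n) := by
  interval_cases n
  exacts [forcedJet_zero p q s d F m, forcedJet_one p q s d F m]

lemma forcedJet_add_two (d F : ℕ × ℕ → ℝ) (n m : ℕ) :
    forcedJet p q s d F (n + 2) m = -forcedJet p q s d F n (m + 2)
      - lowerOrderJet p q s (fun m n => forcedJet p q s d F n m) F m n := by
  rw [forcedJet]
  rfl

variable {p q s} {J J' : ℕ → ℕ → ℝ} {d d' F F' : ℕ × ℕ → ℝ}

lemma lowerOrderJet_congr {m n : ℕ} (hJ : ∀ i j, i + j ≤ m + n + 1 → j ≤ n + 1 → J i j = J' i j)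
    (hF : ∀ r : ℕ × ℕ, r.1 + r.2 ≤ m + n → F r = F' r) :
    lowerOrderJet p q s J F m n = lowerOrderJet p q s J' F' m n := by
  refine Finset.sum_congr rfl fun i hi => Finset.sum_congr rfl fun j hj => ?_
  rw [Finset.mem_range] at hi hj
  rw [hJ _ _ (by omega) (by omega), hJ _ _ (by omega) (by omega), hF _ (by dsimp only; omega)]

lemma lowerOrderJet_add (m n : ℕ) : lowerOrderJet p q s (J + J') (F + F') m n
    = lowerOrderJet p q s J F m n + lowerOrderJet p q s J' F' m n := by
  simp only [lowerOrderJet, ← Finset.sum_add_distrib, Pi.add_apply]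
  refine Finset.sum_congr rfl fun i _ => Finset.sum_congr rfl fun j _ => ?_
  ring

lemma lowerOrderJet_smul (c : ℝ) (m n : ℕ) :
    lowerOrderJet p q s (c • J) (c • F) m n = c * lowerOrderJet p q s J F m n := by
  simp only [lowerOrderJet, Finset.mul_sum, Pi.smul_apply, smul_eq_mul]
  refine Finset.sum_congr rfl fun i _ => Finset.sum_congr rfl fun j _ => ?_
  ring

lemma lowerOrderJet_eq_leading {m n : ℕ} (hJ : ∀ i j, i + j ≤ m + n → j ≤ n + 1 → J i j = 0)
    (hF : ∀ r : ℕ × ℕ, r.1 + r.2 < m + n → F r = 0) :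
    lowerOrderJet p q s J F m n
      = p 0 0 * J (m + 1) n + q 0 0 * J m (n + 1) + s 0 0 * F (m, n) := by
  have hterm {i j : ℕ} (hi : i ≤ m) (hj : j ≤ n) (hij : 0 < i + j) :
      (m.choose i : ℝ) * (n.choose j : ℝ) * (p i j * J (m - i + 1) (n - j)
        + q i j * J (m - i) (n - j + 1) + s i j * F (m - i, n - j)) = 0 := by
    rw [hJ _ _ (by omega) (by omega), hJ _ _ (by omega) (by omega), hF _ (by dsimp only; omega)]
    ring
  simp only [lowerOrderJet, ← Finset.sum_product']
  rw [Finset.sum_eq_single (0, 0)]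
  · simp
  · rintro ⟨i, j⟩ hij h0
    simp only [Finset.mem_product, Finset.mem_range, ne_eq, Prod.mk.injEq] at hij h0
    exact hterm (by omega) (by omega) (by omega)
  · simp

lemma eq_forcedJet_of_recursion {K : ℕ}
    (h0 : ∀ m, m ≤ K + 2 → J m 0 = d (m, 0)) (h1 : ∀ m, m + 1 ≤ K + 2 → J m 1 = d (m, 1))
    (h2 : ∀ m n, m + n ≤ K → J m (n + 2) = -J (m + 2) n - lowerOrderJet p q s J F m n) :
    ∀ m n, m + n ≤ K + 2 → J m n = forcedJet p q s d F n m := by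
  intro m n
  induction n using Nat.strong_induction_on generalizing m with
  | _ n ih =>
    intro hmn
    match n, ih, hmn with
    | 0, _, hmn => rw [forcedJet_zero, h0 m (by omega)]
    | 1, _, hmn => rw [forcedJet_one, h1 m (by omega)]
    | n + 2, ih, hmn =>
      rw [forcedJet_add_two, h2 m n (by omega), ih n (by omega) (m + 2) (by omega),
        lowerOrderJet_congr (fun i j _ _ => ih j (by omega) i (by omega)) fun _ _ => rfl]

lemma forcedJet_congr {K : ℕ} (hd : ∀ r : ℕ × ℕ, r.2 ≤ 1 → r.1 + r.2 ≤ K + 2 → d r = d' r)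
    (hF : ∀ r : ℕ × ℕ, r.1 + r.2 ≤ K → F r = F' r) {m n : ℕ} (hmn : m + n ≤ K + 2) :
    forcedJet p q s d F n m = forcedJet p q s d' F' n m := by
  refine eq_forcedJet_of_recursion (J := fun m n => forcedJet p q s d F n m) (K := K)
    (fun m hm => ?_) (fun m hm => ?_) (fun m n hmn => ?_) m n hmn
  · rw [forcedJet_zero, hd (m, 0) (by simp) (by simpa using hm)]
  · rw [forcedJet_one, hd (m, 1) (by simp) (by simpa using hm)]
  · rw [forcedJet_add_two, lowerOrderJet_congr (fun _ _ _ _ => rfl) fun r hr => hF r (by omega)]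

variable (p q s) in
/-- `forcedJet`, bundled as a linear functional of the data `(d, F)`. -/
def forcedJetₗ (m n : ℕ) : (ℕ × ℕ → ℝ) × (ℕ × ℕ → ℝ) →ₗ[ℝ] ℝ where
  toFun dF := forcedJet p q s dF.1 dF.2 n m
  map_add' dF dF' := by
    refine (eq_forcedJet_of_recursion (K := m + n) (J := (fun m n => forcedJet p q s dF.1 dF.2 n m)
      + fun m n => forcedJet p q s dF'.1 dF'.2 n m) (fun m _ => ?_) (fun m _ => ?_)
      (fun m n _ => ?_) m n (by omega)).symm
    · simp [forcedJet_zero]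
    · simp [forcedJet_one]
    · rw [Prod.snd_add, lowerOrderJet_add, Pi.add_apply, Pi.add_apply, forcedJet_add_two,
        forcedJet_add_two, Pi.add_apply, Pi.add_apply]
      ring
  map_smul' c dF := by
    refine (eq_forcedJet_of_recursion (K := m + n)
      (J := c • fun m n => forcedJet p q s dF.1 dF.2 n m) (fun m _ => ?_) (fun m _ => ?_)
      (fun m n _ => ?_) m n (by omega)).symm
    · simp [forcedJet_zero]
    · simp [forcedJet_one]
    · rw [Prod.smul_snd, lowerOrderJet_smul, Pi.smul_apply, Pi.smul_apply, forcedJet_add_two,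
        Pi.smul_apply, Pi.smul_apply]
      simp only [smul_eq_mul]
      ring

lemma forcedJet_expand {K : ℕ} (d F : ℕ × ℕ → ℝ) {m n : ℕ} (hmn : m + n ≤ K + 2) :
    forcedJet p q s d F n m
      = ∑ r ∈ (Lam (K + 2)).filter (fun r => r.2 ≤ 1), d r * forcedJet p q s (Pi.single r 1) 0 n m
        + ∑ r ∈ Lam K, F r * forcedJet p q s 0 (Pi.single r 1) n m := by
  set dF : (ℕ × ℕ → ℝ) × (ℕ × ℕ → ℝ) :=
    ∑ r ∈ (Lam (K + 2)).filter (fun r => r.2 ≤ 1), d r • (Pi.single r 1, 0)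
      + ∑ r ∈ Lam K, F r • (0, Pi.single r 1) with hdF
  have hcongr : forcedJet p q s d F n m = forcedJetₗ p q s m n dF := by
    refine forcedJet_congr (fun r hr hr' => ?_) (fun r hr => ?_) hmn
    · simp [hdF, Prod.fst_sum, Finset.sum_apply, Pi.single_apply, mem_Lam, hr, hr']
    · simp [hdF, Prod.snd_sum, Finset.sum_apply, Pi.single_apply, mem_Lam, hr]
  rw [hcongr, hdF, map_add, map_sum, map_sum]
  simp only [map_smul, smul_eq_mul]
  rfl

lemma forcedJet_eq_zero_of_lt {K : ℕ}
    (hd : ∀ r : ℕ × ℕ, r.2 ≤ 1 → r.1 + r.2 < K → d r = 0)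
    (hF : ∀ r : ℕ × ℕ, r.1 + r.2 + 2 < K → F r = 0) {m n : ℕ} (hmn : m + n < K) :
    forcedJet p q s d F n m = 0 := by
  rcases Nat.lt_or_ge n 2 with hn | hn
  · rw [forcedJet_of_le_one _ _ _ _ _ _ (by omega), hd _ (by dsimp only; omega) hmn]
  · obtain ⟨K, rfl⟩ : ∃ L, K = L + 3 := ⟨K - 3, by omega⟩
    rw [forcedJet_congr (K := K) (d' := 0) (F' := 0) (fun r hr hr' => hd r hr (by omega))
      (fun r hr => hF r (by omega)) (by omega)]
    exact map_zero (forcedJetₗ p q s m n)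

lemma forcedJet_principal {K : ℕ}
    (hd : ∀ r : ℕ × ℕ, r.2 ≤ 1 → r.1 + r.2 < K → d r = 0)
    (hF : ∀ r : ℕ × ℕ, r.1 + r.2 + 2 < K → F r = 0) {m n : ℕ} (hmn : m + n + 2 = K) :
    forcedJet p q s d F (n + 2) m = -forcedJet p q s d F n (m + 2) - s 0 0 * F (m, n) := by
  have hzero (i j : ℕ) (hij : i + j < K) : forcedJet p q s d F j i = 0 :=
    forcedJet_eq_zero_of_lt hd hF hij
  rw [forcedJet_add_two, lowerOrderJet_eq_leading (fun i j _ _ => hzero i j (by omega))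
    fun r hr => hF r (by omega), hzero (m + 1) n (by omega), hzero m (n + 1) (by omega)]
  ring

lemma forcedJet_subprincipal {K : ℕ} (hd : ∀ r : ℕ × ℕ, r.2 ≤ 1 → r.1 + r.2 < K → d r = 0)
    {m n : ℕ} (hmn : m + n + 1 = K) :
    forcedJet p q s d 0 (n + 2) m = -forcedJet p q s d 0 n (m + 2)
      - (p 0 0 * forcedJet p q s d 0 n (m + 1) + q 0 0 * forcedJet p q s d 0 (n + 1) m) := by
  have hzero (i j : ℕ) (hij : i + j ≤ m + n) (_ : j ≤ n + 1) : forcedJet p q s d 0 j i = 0 :=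
    forcedJet_eq_zero_of_lt hd (fun _ _ => rfl) (by omega)
  rw [forcedJet_add_two, lowerOrderJet_eq_leading (F := 0) hzero fun _ _ => rfl]
  simp

lemma single_eq_zero_of_lt {m n : ℕ} (r : ℕ × ℕ) (hr : r.1 + r.2 < m + n) :
    (Pi.single (m, n) 1 : ℕ × ℕ → ℝ) r = 0 :=
  Pi.single_eq_of_ne (by rintro rfl; exact hr.false) _

lemma forcedJet_single_left_principal {m n m' n' : ℕ} (h : m' + n' + 2 = m + n) :
    forcedJet p q s (Pi.single (m, n) 1) 0 (n' + 2) m'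
      = -forcedJet p q s (Pi.single (m, n) 1) 0 n' (m' + 2) := by
  rw [forcedJet_principal (F := 0) (fun r _ => single_eq_zero_of_lt r) (fun _ _ => rfl) h,
    Pi.zero_apply, mul_zero, sub_zero]

lemma forcedJet_single_right_principal {m n m' n' : ℕ} (h : m' + n' = m + n) :
    forcedJet p q s 0 (Pi.single (m, n) 1) (n' + 2) m'
      = -forcedJet p q s 0 (Pi.single (m, n) 1) n' (m' + 2)
        - s 0 0 * (Pi.single (m, n) 1 : ℕ × ℕ → ℝ) (m', n') :=
  forcedJet_principal (K := m + n + 2) (fun _ _ _ => rfl)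
    (fun r hr => single_eq_zero_of_lt r (by omega)) (by omega)

lemma forcedJet_single_left_diagonal {n : ℕ} (hn : n ≤ 1) (l m : ℕ) :
    forcedJet p q s (Pi.single (m + 2 * l, n) 1) 0 (n + 2 * l) m = (-1) ^ l := by
  induction l generalizing m with
  | zero => simp [forcedJet_of_le_one _ _ _ _ _ _ hn]
  | succ l ih =>
    rw [mul_add, mul_one, ← add_assoc n, forcedJet_single_left_principal (by omega),
      add_comm (2 * l), ← add_assoc m, ih, pow_succ, mul_neg_one]

lemma forcedJet_single_left_eq_zero {m n m' n' : ℕ} (h : m' + n' ≤ m + n ∨ n' ≤ 1)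
    (hne : ∀ l, m' + 2 * l = m → n' ≠ n + 2 * l) :
    forcedJet p q s (Pi.single (m, n) 1) 0 n' m' = 0 := by
  induction n' using Nat.strong_induction_on generalizing m' with
  | _ n' ih =>
    rcases Nat.lt_or_ge n' 2 with hn' | hn'
    · rw [forcedJet_of_le_one _ _ _ _ _ _ (by omega), Pi.single_eq_of_ne]
      rw [ne_eq, Prod.mk.injEq]
      exact fun hmn => hne 0 hmn.1 hmn.2
    obtain ⟨n', rfl⟩ := Nat.exists_eq_add_of_le' hn'
    rcases (h.resolve_right (by omega)).lt_or_eq with hlt | heq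
    · exact forcedJet_eq_zero_of_lt (fun r _ => single_eq_zero_of_lt r) (fun _ _ => rfl) hlt
    · rw [forcedJet_single_left_principal (by omega), ih n' (by omega) (by omega) fun l hl => ?_,
        neg_zero]
      have := hne (l + 1) (by omega)
      omega

lemma forcedJet_single_right_eq_zero {m n m' n' : ℕ} (h : m' + n' ≤ m + n + 2 ∨ n' ≤ 1)
    (hne : ∀ l, m' + 2 * l = m → n' ≠ n + 2 * l + 2) :
    forcedJet p q s 0 (Pi.single (m, n) 1) n' m' = 0 := by
  induction n' using Nat.strong_induction_on generalizing m' with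
  | _ n' ih =>
    rcases Nat.lt_or_ge n' 2 with hn' | hn'
    · rw [forcedJet_of_le_one _ _ _ _ _ _ (by omega), Pi.zero_apply]
    obtain ⟨n', rfl⟩ := Nat.exists_eq_add_of_le' hn'
    rcases (h.resolve_right (by omega)).lt_or_eq with hlt | heq
    · exact forcedJet_eq_zero_of_lt (K := m + n + 2) (fun _ _ _ => rfl)
        (fun r hr => single_eq_zero_of_lt r (by omega)) hlt
    · rw [forcedJet_single_right_principal (by omega),
        ih n' (by omega) (by omega) fun l hl => ?_, Pi.single_eq_of_ne, mul_zero, neg_zero,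
        sub_zero]
      · rw [ne_eq, Prod.mk.injEq]
        have := hne 0
        omega
      · have := hne (l + 1) (by omega)
        omega

lemma forcedJet_single_right_diagonal (l m n : ℕ) :
    forcedJet p q s 0 (Pi.single (m + 2 * l, n) 1) (n + 2 * l + 2) m = (-1) ^ (l + 1) * s 0 0 := by
  rw [forcedJet_single_right_principal (by ring)]
  induction l generalizing m with
  | zero =>
    rw [forcedJet_single_right_eq_zero (by omega) (by omega)]
    simp
  | succ l ih =>
    rw [Pi.single_eq_of_ne (by simp), mul_zero, sub_zero, mul_add, mul_one, ← add_assoc n,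
      add_comm (2 * l), ← add_assoc m, forcedJet_single_right_principal (by omega), ih,
      pow_succ (-1 : ℝ) (l + 1)]
    ring

end ForcedJet

/-! ### The polynomials `G^H` and `Q^H` as sums over forced jets -/

/-- The normalized monomial `x^m y^n / (m! n!)`. -/
def taylorMonomial (r : ℕ × ℕ) (x y : ℝ) : ℝ :=
  x ^ r.1 * y ^ r.2 / ((r.1.factorial : ℝ) * (r.2.factorial : ℝ))

section Polynomials

variable (S : Set (ℝ × ℝ)) (a : ℝ × ℝ → ℝ) (z₀ : ℝ × ℝ)

lemma injOn_antidiagonal_step (m n : ℕ) :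
    InjOn (fun l => (m - 2 * l, n + 2 * l)) (Finset.range (m / 2 + 1)) := fun l _ l' _ h => by
  simp only [Prod.mk.injEq] at h
  omega

lemma GH_eq_sum {M m n : ℕ} (hn : n ≤ 1) (hmn : m + n ≤ M + 1) (x y : ℝ) :
    GH S a z₀ M m n x y = ∑ r ∈ Lam (M + 1), AHu S a z₀ r.1 r.2 m n * taylorMonomial r x y := by
  have hsub : LamH2 (M + 1) \ LamH2 (m + n) ⊆ Lam (M + 1) :=
    Finset.sdiff_subset.trans (Finset.filter_subset _ _)
  rw [← Finset.sum_sdiff hsub, GH]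
  congr 1
  refine Finset.sum_of_injOn (fun l => (m - 2 * l, n + 2 * l)) (injOn_antidiagonal_step m n)
    (fun l hl => ?_) (fun r hr hr' => ?_) fun l hl => ?_
  · simp only [Finset.coe_range, mem_Iio, Finset.mem_coe, Finset.mem_sdiff, mem_LamH2,
      mem_Lam] at hl ⊢
    omega
  · simp only [Finset.mem_sdiff, mem_LamH2, mem_Lam, Finset.coe_range, mem_image, mem_Iio,
      not_exists, Prod.ext_iff] at hr hr'
    rw [AHu, coeffJet, forcedJet_single_left_eq_zero (by omega), zero_mul]
    intro l hl hl'
    exact hr' l ⟨by omega, by omega, hl'.symm⟩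
  · obtain ⟨k, rfl⟩ : ∃ k, m = k + 2 * l := ⟨m - 2 * l, by grind⟩
    rw [AHu, coeffJet, Nat.add_sub_cancel, forcedJet_single_left_diagonal hn, taylorMonomial]
    ring

lemma QH_eq_sum {M m n : ℕ} (hmn : m + n + 2 ≤ M + 1) (x y : ℝ) :
    QH S a z₀ M m n x y = ∑ r ∈ Lam (M + 1), AHf S a z₀ r.1 r.2 m n * taylorMonomial r x y := by
  have hsub : LamH2 (M + 1) \ LamH2 (m + n + 2) ⊆ Lam (M + 1) :=
    Finset.sdiff_subset.trans (Finset.filter_subset _ _)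
  rw [← Finset.sum_sdiff hsub, QH]
  congr 1
  refine Finset.sum_of_injOn (fun l => (m + 2 - 2 * l, n + 2 * l))
    ((injOn_antidiagonal_step (m + 2) n).mono fun l hl => ?_) (fun l hl => ?_)
    (fun r hr hr' => ?_) fun l hl => ?_
  · simp only [Finset.coe_Icc, mem_Icc, Finset.coe_range, mem_Iio] at hl ⊢
    omega
  · simp only [Finset.coe_Icc, mem_Icc, Finset.mem_coe, Finset.mem_sdiff, mem_LamH2,
      mem_Lam] at hl ⊢
    omega
  · simp only [Finset.mem_sdiff, mem_LamH2, mem_Lam, Finset.coe_Icc, mem_image, mem_Icc,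
      not_exists, Prod.ext_iff] at hr hr'
    rw [AHf, coeffJet, forcedJet_single_right_eq_zero (by omega), zero_mul]
    intro l hl hl'
    exact hr' (l + 1) ⟨by omega, by omega, by omega⟩
  · obtain ⟨k, j, rfl, rfl⟩ : ∃ k j, m = k + 2 * j ∧ l = j + 1 :=
      ⟨m + 2 - 2 * l, l - 1, by grind, by grind⟩
    rw [show k + 2 * j + 2 - 2 * (j + 1) = k by omega, AHf, coeffJet, mul_add, ← add_assoc n,
      mul_one, forcedJet_single_right_diagonal, taylorMonomial]
    simp only [partialD, Function.iterate_zero, id]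
    ring

end Polynomials

/-! ### Jets of solutions of the equation -/

section EquationJets

/-- `-∇ · (a ∇u)`, with derivatives relative to `S`. -/
def ellipticSource (S : Set (ℝ × ℝ)) (a u : ℝ × ℝ → ℝ) (z : ℝ × ℝ) : ℝ :=
  -(partialX S (fun w => a w * partialX S u w) z + partialY S (fun w => a w * partialY S u w) z)

/-- `lowerOrderJet` for the coefficient `a` at the base point `z₀`. -/
def coeffLowerOrderJet (S : Set (ℝ × ℝ)) (a : ℝ × ℝ → ℝ) (z₀ : ℝ × ℝ) (J : ℕ → ℕ → ℝ)
    (F : ℕ × ℕ → ℝ) (m n : ℕ) : ℝ :=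
  lowerOrderJet (fun i j => partialD S i j (fun z => partialX S a z / a z) z₀)
    (fun i j => partialD S i j (fun z => partialY S a z / a z) z₀)
    (fun i j => partialD S i j (fun z => 1 / a z) z₀) J F m n

variable {S : Set (ℝ × ℝ)} {a u : ℝ × ℝ → ℝ} {N : ℕ}

lemma coeffJet_add_two (z₀ : ℝ × ℝ) (d F : ℕ × ℕ → ℝ) (m n : ℕ) :
    coeffJet S a z₀ d F m (n + 2) = -coeffJet S a z₀ d F (m + 2) n
      - coeffLowerOrderJet S a z₀ (coeffJet S a z₀ d F) F m n :=
  forcedJet_add_two ..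

lemma contDiffOn_ellipticSource (hS : UniqueDiffOn ℝ S) (ha : ContDiffOn ℝ (N + 1 : ℕ) a S)
    (hu : ContDiffOn ℝ (N + 2 : ℕ) u S) : ContDiffOn ℝ N (ellipticSource S a u) S :=
  ((contDiffOn_partialX hS (ha.mul (contDiffOn_partialX hS hu))).add
    (contDiffOn_partialY hS (ha.mul (contDiffOn_partialY hS hu)))).neg

lemma partialY_partialY_eq (hS : UniqueDiffOn ℝ S) (ha : ContDiffOn ℝ 1 a S)
    (ha₀ : ∀ z ∈ S, a z ≠ 0) (hu : ContDiffOn ℝ 2 u S) :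
    EqOn (partialY S (partialY S u)) (fun z => -(partialX S (partialX S u) z
      + (partialX S a z / a z * partialX S u z + partialY S a z / a z * partialY S u z
        + 1 / a z * ellipticSource S a u z))) S := by
  intro z hz
  have ha' := ha.differentiableOn one_ne_zero
  have hX : partialX S (fun w => a w * partialX S u w) z
      = a z * partialX S (partialX S u) z + partialX S a z * partialX S u z :=
    dirD_mul hS ha' ((contDiffOn_partialX hS (n := 1) hu).differentiableOn one_ne_zero) hz
  have hY : partialY S (fun w => a w * partialY S u w) z
      = a z * partialY S (partialY S u) z + partialY S a z * partialY S u z :=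
    dirD_mul hS ha' ((contDiffOn_partialY hS (n := 1) hu).differentiableOn one_ne_zero) hz
  have := ha₀ z hz
  simp only [ellipticSource, hX, hY]
  field_simp
  ring

lemma partialD_lowerOrder (hS : UniqueDiffOn ℝ S) (hcl : S ⊆ closure (interior S)) {m n : ℕ}
    {p q s f : ℝ × ℝ → ℝ} (hp : ContDiffOn ℝ (m + n : ℕ) p S) (hq : ContDiffOn ℝ (m + n : ℕ) q S)
    (hs : ContDiffOn ℝ (m + n : ℕ) s S) (hf : ContDiffOn ℝ (m + n : ℕ) f S)
    (hu : ContDiffOn ℝ (m + n + 1 : ℕ) u S) {z : ℝ × ℝ} (hz : z ∈ S) :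
    partialD S m n (fun z => p z * partialX S u z + q z * partialY S u z + s z * f z) z
      = lowerOrderJet (fun i j => partialD S i j p z) (fun i j => partialD S i j q z)
          (fun i j => partialD S i j s z) (fun i j => partialD S i j u z)
          (fun r => partialD S r.1 r.2 f z) m n := by
  have hX := contDiffOn_partialX hS hu
  have hY := contDiffOn_partialY hS hu
  rw [partialD_add hS m n ((hp.mul hX).add (hq.mul hY)) (hs.mul hf) hz]
  simp only
  rw [partialD_add hS m n (hp.mul hX) (hq.mul hY) hz]
  simp only
  rw [partialD_mul hS m n hp hX hz, partialD_mul hS m n hq hY hz, partialD_mul hS m n hs hf hz]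
  simp only [lowerOrderJet, ← Finset.sum_add_distrib]
  refine Finset.sum_congr rfl fun i hi => Finset.sum_congr rfl fun j hj => ?_
  rw [Finset.mem_range] at hi hj
  rw [partialD_partialX hS hcl _ _ (hu.of_le (by norm_cast; omega)) hz, ← partialD_succ_right]
  ring

lemma partialD_add_two_eq (hS : UniqueDiffOn ℝ S) (hcl : S ⊆ closure (interior S))
    (ha : ContDiffOn ℝ (N + 1 : ℕ) a S) (ha₀ : ∀ z ∈ S, a z ≠ 0)
    (hu : ContDiffOn ℝ (N + 2 : ℕ) u S) {z : ℝ × ℝ} (hz : z ∈ S) {m n : ℕ} (hmn : m + n ≤ N) :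
    partialD S m (n + 2) u z = -partialD S (m + 2) n u z
      - coeffLowerOrderJet S a z (fun i j => partialD S i j u z)
          (fun r => partialD S r.1 r.2 (ellipticSource S a u) z) m n := by
  replace ha : ContDiffOn ℝ (m + n + 1 : ℕ) a S := ha.of_le (by norm_cast; omega)
  replace hu : ContDiffOn ℝ (m + n + 2 : ℕ) u S := hu.of_le (by norm_cast; omega)
  have ha' : ContDiffOn ℝ (m + n : ℕ) a S := ha.of_le (by norm_cast; omega)
  have hu' : ContDiffOn ℝ (m + n + 1 : ℕ) u S := hu.of_le (by norm_cast; omega)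
  have hp : ContDiffOn ℝ (m + n : ℕ) (fun z => partialX S a z / a z) S :=
    (contDiffOn_partialX hS ha).div ha' ha₀
  have hq : ContDiffOn ℝ (m + n : ℕ) (fun z => partialY S a z / a z) S :=
    (contDiffOn_partialY hS ha).div ha' ha₀
  have hs : ContDiffOn ℝ (m + n : ℕ) (fun z => 1 / a z) S := contDiffOn_const.div ha' ha₀
  have hf := contDiffOn_ellipticSource hS ha hu
  have hX := contDiffOn_partialX hS hu
  have hXX := contDiffOn_partialX hS hX
  have hlow := ((hp.mul (contDiffOn_partialX hS hu')).add
    (hq.mul (contDiffOn_partialY hS hu'))).add (hs.mul hf)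
  have heq := partialY_partialY_eq hS (ha.of_le (by norm_cast; omega)) ha₀
    (hu.of_le (by norm_cast; omega))
  rw [partialD_succ_right, partialD_succ_right, partialD_congr m n heq hz,
    partialD_neg hS m n (hXX.add hlow) hz]
  simp only
  rw [partialD_add hS m n hXX hlow hz]
  simp only
  rw [partialD_lowerOrder hS hcl hp hq hs hf hu' hz, partialD_partialX hS hcl m n hX hz,
    partialD_partialX hS hcl (m + 1) n (hu.of_le (by norm_cast; omega)) hz, neg_add, sub_eq_add_neg]
  rfl

lemma partialD_eq_coeffJet (hS : UniqueDiffOn ℝ S) (hcl : S ⊆ closure (interior S))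
    (ha : ContDiffOn ℝ (N + 1 : ℕ) a S) (ha₀ : ∀ z ∈ S, a z ≠ 0)
    (hu : ContDiffOn ℝ (N + 2 : ℕ) u S) {z : ℝ × ℝ} (hz : z ∈ S) {m n : ℕ}
    (hmn : m + n ≤ N + 2) :
    partialD S m n u z = coeffJet S a z (fun r => partialD S r.1 r.2 u z)
      (fun r => partialD S r.1 r.2 (ellipticSource S a u) z) m n :=
  eq_forcedJet_of_recursion (K := N) (J := fun m n => partialD S m n u z) (fun _ _ => rfl)
    (fun _ _ => rfl) (fun _ _ hmn => partialD_add_two_eq hS hcl ha ha₀ hu hz hmn) m n hmn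

lemma partialD_ellipticSource_eq_zero (hS : UniqueDiffOn ℝ S) (hcl : S ⊆ closure (interior S))
    (ha : ContDiffOn ℝ (N + 1 : ℕ) a S) (ha₀ : ∀ z ∈ S, a z ≠ 0)
    (hu : ContDiffOn ℝ (N + 2 : ℕ) u S) {z : ℝ × ℝ} (hz : z ∈ S) {d : ℕ × ℕ → ℝ}
    (hd : ∀ m n, m + n ≤ N + 2 → partialD S m n u z = coeffJet S a z d 0 m n) {m n : ℕ}
    (hmn : m + n ≤ N) : partialD S m n (ellipticSource S a u) z = 0 := by
  induction hk : m + n using Nat.strong_induction_on generalizing m n with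
  | _ k ih =>
    set F : ℕ × ℕ → ℝ := fun r => partialD S r.1 r.2 (ellipticSource S a u) z
    have hF (r : ℕ × ℕ) (hr : r.1 + r.2 < m + n) : F r = 0 := ih _ (by omega) (by omega) rfl
    have hlow : coeffLowerOrderJet S a z (coeffJet S a z d 0) 0 m n
        = coeffLowerOrderJet S a z (coeffJet S a z d 0) F m n := by
      have hu_eq := partialD_add_two_eq hS hcl ha ha₀ hu hz hmn
      rw [hd m (n + 2) (by omega), hd (m + 2) n (by omega), coeffJet_add_two, sub_right_inj]
        at hu_eq
      exact hu_eq.trans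
        (lowerOrderJet_congr (fun i j hij _ => hd i j (by omega)) fun _ _ => rfl)
    have hsplit : coeffLowerOrderJet S a z (coeffJet S a z d 0) F m n
        = coeffLowerOrderJet S a z (coeffJet S a z d 0) 0 m n
          + coeffLowerOrderJet S a z 0 F m n := by
      simpa only [coeffLowerOrderJet, add_zero, zero_add]
        using lowerOrderJet_add (J := coeffJet S a z d 0) (J' := 0) (F := 0) (F' := F) m n
    have hlead : coeffLowerOrderJet S a z 0 F m n = 1 / a z * F (m, n) := by
      rw [coeffLowerOrderJet, lowerOrderJet_eq_leading (J := 0) (fun _ _ _ _ => rfl) hF]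
      simp [partialD]
    have hzero : 1 / a z * F (m, n) = 0 := by rw [← hlead]; linarith
    exact (mul_eq_zero.mp hzero).resolve_left (one_div_ne_zero (ha₀ z hz))

end EquationJets

/-! ### Exact solutions at the bottom side -/

namespace InterfaceDomain

variable (D : InterfaceDomain)

lemma closure_Ω : closure D.Ω = Icc D.l₁ D.l₂ ×ˢ Icc D.l₃ D.l₄ := by
  rw [Ω, closure_prod_eq, closure_Ioo D.lt₁₂.ne, closure_Ioo D.lt₃₄.ne]

lemma Ω_diff_interface_eq : D.Ω \ D.interface = D.Ω \ closure D.interface := by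
  have hψ : closure D.interface ⊆ {z | D.ψ z = 0} :=
    closure_minimal (fun z hz => hz.2) (isClosed_eq D.smooth_ψ.continuous continuous_const)
  exact Subset.antisymm (fun z hz => ⟨hz.1, fun h => hz.2 ⟨hz.1, hψ h⟩⟩)
    (sdiff_subset_sdiff_right subset_closure)

lemma isOpen_Ω_diff_interface : IsOpen (D.Ω \ D.interface) := by
  rw [Ω_diff_interface_eq]
  exact (isOpen_Ioo.prod isOpen_Ioo).sdiff isClosed_closure

lemma Ω_diff_interface_subset : D.Ω \ D.interface ⊆ D.region := by
  rw [Ω_diff_interface_eq, region, ← closure_Ω]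
  exact sdiff_subset_sdiff_left subset_closure

lemma region_subset_closure : D.region ⊆ closure (D.Ω \ D.interface) := by
  rw [Ω_diff_interface_eq, region, ← closure_Ω, sdiff_eq, sdiff_eq]
  exact isClosed_closure.isOpen_compl.closure_inter

lemma Ω_diff_interface_subset_interior : D.Ω \ D.interface ⊆ interior D.region :=
  interior_maximal D.Ω_diff_interface_subset D.isOpen_Ω_diff_interface

lemma region_subset_closure_interior : D.region ⊆ closure (interior D.region) :=
  D.region_subset_closure.trans (closure_mono D.Ω_diff_interface_subset_interior)

lemma uniqueDiffOn_region : UniqueDiffOn ℝ D.region :=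
  ((uniqueDiffOn_Icc D.lt₁₂).prod (uniqueDiffOn_Icc D.lt₃₄)).inter isClosed_closure.isOpen_compl

variable {D}

lemma mem_region_bottom {x : ℝ} (hx : x ∈ Ioo D.l₁ D.l₂) (h : (x, D.l₃) ∉ closure D.interface) :
    (x, D.l₃) ∈ D.region :=
  ⟨⟨Ioo_subset_Icc_self hx, left_mem_Icc.mpr D.lt₃₄.le⟩, h⟩

lemma eventually_mem_region {x₀ : ℝ} (hx₀ : x₀ ∈ Ioo D.l₁ D.l₂)
    (hreg : (x₀, D.l₃) ∉ closure D.interface) {e : ℝ × ℝ} (he : 0 ≤ e.2) :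
    ∀ᶠ t in 𝓝[≥] (0 : ℝ), (x₀, D.l₃) + t • e ∈ D.region := by
  have hc : Tendsto (fun t : ℝ => (x₀, D.l₃) + t • e) (𝓝 0) (𝓝 (x₀, D.l₃)) :=
    Continuous.tendsto' (by fun_prop) _ _ (by simp)
  have hnear : Ioo D.l₁ D.l₂ ×ˢ Iio D.l₄ \ closure D.interface ∈ 𝓝 (x₀, D.l₃) :=
    ((isOpen_Ioo.prod isOpen_Iio).sdiff isClosed_closure).mem_nhds ⟨⟨hx₀, D.lt₃₄⟩, hreg⟩
  filter_upwards [nhdsWithin_le_nhds (hc hnear), self_mem_nhdsWithin] with t ht ht₀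
  exact ⟨⟨Ioo_subset_Icc_self ht.1.1, le_add_of_nonneg_right (mul_nonneg ht₀ he), ht.1.2.le⟩, ht.2⟩

variable {k : ℕ∞} {a u f v : ℝ × ℝ → ℝ} {g : ℝ → ℝ}

lemma PiecewiseSmooth.contDiffOn_nat (h : D.PiecewiseSmooth k v) {n : ℕ} (hn : (n : ℕ∞) ≤ k) :
    ContDiffOn ℝ n v D.region :=
  h.contDiffOn.of_le (by exact_mod_cast hn)

lemma IsSolution.ellipticSource_eqOn (h : D.IsSolution k a u f g)
    (ha : ContDiffOn ℝ 1 a D.region) : EqOn (ellipticSource D.region a u) f D.region :=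
  Set.EqOn.of_subset_closure h.pde
    (contDiffOn_ellipticSource (N := 0) D.uniqueDiffOn_region ha
      (h.smooth_u.contDiffOn_nat le_add_self)).continuousOn
    h.smooth_f.continuousOn D.Ω_diff_interface_subset D.region_subset_closure

lemma IsSolution.iteratedDeriv_neumann (h : D.IsSolution k a u f g) {m : ℕ} (hm : (m : ℕ∞) ≤ k)
    {x : ℝ} (hx : x ∈ Ioo D.l₁ D.l₂) (hreg : (x, D.l₃) ∉ closure D.interface) :
    iteratedDeriv m g x = -partialD D.region m 1 u (x, D.l₃) := by
  induction m generalizing x with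
  | zero =>
    rw [iteratedDeriv_zero, ← h.neumann x hx hreg]
    simp [partialD, partialY, ← map_neg]
  | succ m ih =>
    have hnear : ∀ᶠ y in 𝓝 x, y ∈ Ioo D.l₁ D.l₂ ∧ (y, D.l₃) ∉ closure D.interface :=
      (isOpen_Ioo.inter (isClosed_closure.isOpen_compl.preimage (by fun_prop))).mem_nhds ⟨hx, hreg⟩
    have hu : ContDiffOn ℝ (1 + m + 1 : ℕ) u D.region := h.smooth_u.contDiffOn_nat <| by
      rw [add_comm 1 m]
      exact_mod_cast add_le_add hm one_le_two
    have hD := (contDiffOn_partialD D.uniqueDiffOn_region m 1 hu).differentiableOn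
      (by simp) _ (mem_region_bottom hx hreg)
    have hline : HasDerivAt (fun x : ℝ => (x, D.l₃)) ((1 : ℝ), (0 : ℝ)) x :=
      (hasDerivAt_id x).prodMk (hasDerivAt_const x _)
    have hderiv := (hD.hasFDerivWithinAt.comp_hasDerivAt x hline
      (hnear.mono fun y hy => mem_region_bottom hy.1 hy.2)).neg
    rw [iteratedDeriv_succ, partialD_succ_left]
    refine (hderiv.congr_of_eventuallyEq (hnear.mono fun y hy => ?_)).deriv
    rw [ih (le_trans (by exact_mod_cast m.le_succ) hm) hy.1 hy.2]
    rfl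

end InterfaceDomain

/-! ### Taylor polynomials -/

section TaylorPolynomials

variable {S : Set (ℝ × ℝ)}

lemma partialD_separated (hS : UniqueDiffOn ℝ S) {F G : ℝ → ℝ} (hF : ContDiff ℝ ∞ F)
    (hG : ContDiff ℝ ∞ G) (m n : ℕ) :
    EqOn (partialD S m n fun z => F z.1 * G z.2)
      (fun z => iteratedDeriv m F z.1 * iteratedDeriv n G z.2) S := by
  have hX {F G : ℝ → ℝ} (hF : ContDiff ℝ ∞ F) (hG : ContDiff ℝ ∞ G) (e : ℝ × ℝ) :
      EqOn (dirD S e fun z => F z.1 * G z.2)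
        (fun z => e.1 * (deriv F z.1 * G z.2) + e.2 * (F z.1 * deriv G z.2)) S := fun z hz => by
    have hF' := ((hF.differentiable (by simp)).differentiableAt (x := z.1)).hasDerivAt
    have hG' := ((hG.differentiable (by simp)).differentiableAt (x := z.2)).hasDerivAt
    have hfst : HasFDerivAt Prod.fst (ContinuousLinearMap.fst ℝ ℝ ℝ) z := hasFDerivAt_fst
    have hsnd : HasFDerivAt Prod.snd (ContinuousLinearMap.snd ℝ ℝ ℝ) z := hasFDerivAt_snd
    have hFG : HasFDerivAt (fun z : ℝ × ℝ => F z.1 * G z.2) _ z :=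
      (hF'.comp_hasFDerivAt z hfst).mul (hG'.comp_hasFDerivAt z hsnd)
    rw [dirD, hFG.hasFDerivWithinAt.fderivWithin (hS z hz)]
    simp only [Function.comp_apply, smul_eq_mul, add_apply, smul_apply,
      ContinuousLinearMap.coe_fst', ContinuousLinearMap.coe_snd']
    ring
  have hsucc {F : ℝ → ℝ} (hF : ContDiff ℝ ∞ F) : ContDiff ℝ ∞ (deriv F) :=
    contDiff_infty_iff_deriv.mp hF |>.2
  induction n generalizing G with
  | zero =>
    induction m generalizing F with
    | zero => intro z _; simp [partialD]
    | succ m ih =>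
      refine (partialD_congr m 0 fun z hz => ?_).trans
        ((ih (hsucc hF)).trans fun z _ => by rw [← iteratedDeriv_succ'])
      exact (hX hF hG (1, 0) hz).trans (by simp)
  | succ n ih =>
    refine (partialD_congr m n fun z hz => ?_).trans
      ((ih (hsucc hG)).trans fun z _ => by rw [← iteratedDeriv_succ'])
    exact (hX hF hG (0, 1) hz).trans (by simp)

/-- The polynomial of degree at most `M` whose partial derivatives at `z₀` of order at most `M`
are the `J i j`. -/
def taylorPoly (z₀ : ℝ × ℝ) (M : ℕ) (J : ℕ → ℕ → ℝ) (z : ℝ × ℝ) : ℝ :=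
  ∑ r ∈ Lam M, J r.1 r.2 * taylorMonomial r (z.1 - z₀.1) (z.2 - z₀.2)

variable (z₀ : ℝ × ℝ) (M : ℕ) (J : ℕ → ℕ → ℝ)

lemma contDiff_taylorMonomial (r : ℕ × ℕ) {n : WithTop ℕ∞} :
    ContDiff ℝ n fun z : ℝ × ℝ => taylorMonomial r (z.1 - z₀.1) (z.2 - z₀.2) := by
  unfold taylorMonomial
  fun_prop

lemma contDiff_taylorPoly {n : WithTop ℕ∞} : ContDiff ℝ n (taylorPoly z₀ M J) :=
  ContDiff.sum fun r _ => contDiff_const.mul (contDiff_taylorMonomial z₀ r)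

variable {z₀ M}

lemma partialD_taylorMonomial (hS : UniqueDiffOn ℝ S) (hz : z₀ ∈ S) (r : ℕ × ℕ) (m n : ℕ) :
    partialD S m n (fun z => taylorMonomial r (z.1 - z₀.1) (z.2 - z₀.2)) z₀
      = if (m, n) = r then 1 else 0 := by
  have hpow (c : ℝ) (i k : ℕ) :
      iteratedDeriv k (fun x => (x - c) ^ i / (i.factorial : ℝ)) c = if k = i then 1 else 0 := by
    have := i.factorial_ne_zero
    rw [iteratedDeriv_div_const, iteratedDeriv_comp_sub_const k (· ^ i)]
    simp only [sub_self, iteratedDeriv_fun_pow_zero]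
    split_ifs <;> simp [this]
  simp only [taylorMonomial, mul_div_mul_comm]
  rw [partialD_separated hS (F := fun x => (x - z₀.1) ^ r.1 / (r.1.factorial : ℝ))
    (G := fun y => (y - z₀.2) ^ r.2 / (r.2.factorial : ℝ)) (by fun_prop) (by fun_prop) m n hz]
  simp only [hpow, Prod.ext_iff, ite_and, ite_mul, one_mul, zero_mul]

lemma partialD_taylorPoly (hS : UniqueDiffOn ℝ S) (hz : z₀ ∈ S) {m n : ℕ} (hmn : m + n ≤ M) :
    partialD S m n (taylorPoly z₀ M J) z₀ = J m n := by
  refine (partialD_sum hS m n _ _ _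
    (fun r _ => (contDiff_taylorMonomial z₀ r).contDiffOn) hz).trans ?_
  simp only [partialD_taylorMonomial hS hz, mul_ite, mul_one, mul_zero]
  rw [Finset.sum_ite_eq, if_pos (mem_Lam.mpr hmn)]

variable {e : ℝ × ℝ} {s : Set ℝ}

lemma isLittleO_of_partialD_eq_zero (hS : UniqueDiffOn ℝ S) (hcl : S ⊆ closure (interior S))
    (hs : Convex ℝ s) (h0 : 0 ∈ s) (hmaps : MapsTo (fun t : ℝ => z₀ + t • e) s S) (n : ℕ)
    {w : ℝ × ℝ → ℝ} (hw : ContDiffOn ℝ n w S)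
    (hjet : ∀ i j, i + j ≤ n → partialD S i j w z₀ = 0) :
    (fun t : ℝ => w (z₀ + t • e)) =o[𝓝[s] 0] fun t => t ^ n := by
  have hz : z₀ ∈ S := by simpa using hmaps h0
  induction n generalizing w with
  | zero =>
    simp only [pow_zero, isLittleO_one_iff]
    have hline : ContinuousOn (fun t : ℝ => z₀ + t • e) s := by fun_prop
    have hlim := (hw.continuousOn.comp hline hmaps) 0 h0
    have hw₀ : w z₀ = 0 := hjet 0 0 le_rfl
    simpa [ContinuousWithinAt, hw₀, Function.comp_def] using hlim
  | succ n ih =>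
    have hX := ih (contDiffOn_partialX hS hw) fun i j hij => by
      rw [partialD_partialX hS hcl i j (hw.of_le (by norm_cast; omega)) hz]
      exact hjet _ _ (by omega)
    have hY := ih (contDiffOn_partialY hS hw) fun i j hij => hjet i (j + 1) (by omega)
    have hderiv (t : ℝ) (ht : t ∈ s) : HasDerivWithinAt (fun t => w (z₀ + t • e))
        (e.1 * partialX S w (z₀ + t • e) + e.2 * partialY S w (z₀ + t • e)) s t := by
      rw [← dirD_eq_partialX_partialY]
      have hline : HasDerivAt (fun t : ℝ => z₀ + t • e) e t := by
        simpa using ((hasDerivAt_id t).smul_const e).const_add z₀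
      exact (hw.differentiableOn (by simp) _ (hmaps ht)).hasFDerivWithinAt.comp_hasDerivWithinAt t
        hline.hasDerivWithinAt hmaps
    have hw₀ : w z₀ = 0 := hjet 0 0 (by omega)
    simpa [hw₀] using hs.isLittleO_pow_succ_real h0 hderiv
      (by simpa using (hX.const_mul_left e.1).add (hY.const_mul_left e.2))

lemma sub_taylor_isBigO (hS : UniqueDiffOn ℝ S) (hcl : S ⊆ closure (interior S))
    (hseg : ∀ᶠ t in 𝓝[≥] (0 : ℝ), z₀ + t • e ∈ S) (K : ℕ) {u : ℝ × ℝ → ℝ}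
    (hu : ContDiffOn ℝ (K + 1 : ℕ) u S) :
    (fun t : ℝ => u (z₀ + t • e)
      - ∑ r ∈ Lam K, partialD S r.1 r.2 u z₀ * taylorMonomial r (t * e.1) (t * e.2))
        =O[𝓝[>] 0] fun t => t ^ (K + 1) := by
  set J : ℕ → ℕ → ℝ := fun i j => partialD S i j u z₀
  obtain ⟨δ, hδ, hmaps⟩ := mem_nhdsGE_iff_exists_Icc_subset.mp hseg
  have hz : z₀ ∈ S := by simpa using hmaps (left_mem_Icc.mpr (le_of_lt hδ))
  have hP := (contDiff_taylorPoly z₀ (K + 1) J).contDiffOn (s := S) (n := (K + 1 : ℕ))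
  have hsub := isLittleO_of_partialD_eq_zero hS hcl (convex_Icc 0 δ)
    (left_mem_Icc.mpr (le_of_lt hδ)) hmaps (K + 1) (hu.add hP.neg) fun i j hij => by
      rw [partialD_add hS i j (hu.of_le (by exact_mod_cast hij))
        (hP.neg.of_le (by exact_mod_cast hij)) hz]
      simp only
      rw [partialD_neg hS i j (hP.of_le (by exact_mod_cast hij)) hz]
      simp only
      rw [partialD_taylorPoly J hS hz hij, add_neg_cancel]
  have htop : (fun t : ℝ => ∑ r ∈ Lam (K + 1) \ Lam K, J r.1 r.2 * taylorMonomial r (t * e.1)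
      (t * e.2)) =O[𝓝[>] 0] fun t => t ^ (K + 1) := by
    refine IsBigO.fun_sum fun r hr => ?_
    have hdeg : r.1 + r.2 = K + 1 := by
      simp only [Finset.mem_sdiff, mem_Lam] at hr
      omega
    refine (isBigO_const_mul_self (J r.1 r.2 * taylorMonomial r e.1 e.2)
      (fun t : ℝ => t ^ (K + 1)) _).congr_left fun t => ?_
    rw [← hdeg]
    simp only [taylorMonomial, mul_pow, pow_add]
    ring
  rw [nhdsWithin_Icc_eq_nhdsGE hδ] at hsub
  replace hsub := hsub.isBigO.mono (nhdsWithin_mono 0 Ioi_subset_Ici_self)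
  refine (hsub.add htop).congr_left fun t => ?_
  have hLam : Lam K ⊆ Lam (K + 1) := fun r hr => mem_Lam.mpr ((mem_Lam.mp hr).trans K.le_succ)
  have hsplit := Finset.sum_sdiff hLam
    (f := fun r => J r.1 r.2 * taylorMonomial r (t * e.1) (t * e.2))
  simp only [taylorPoly, ← hsplit, Prod.fst_add, Prod.snd_add, Prod.smul_fst, Prod.smul_snd,
    smul_eq_mul, add_sub_cancel_left]
  ring

end TaylorPolynomials

/-! ### Order six of the Neumann schemes -/

lemma pow_isBigO_pow {a b : ℕ} (h : b ≤ a) :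
    (fun t : ℝ => t ^ a) =O[𝓝[>] 0] fun t => t ^ b := by
  refine IsBigO.of_bound 1 ?_
  filter_upwards [Ioo_mem_nhdsGT one_pos] with t ht
  rw [one_mul, norm_pow, norm_pow, Real.norm_of_nonneg ht.1.le]
  exact pow_le_pow_of_le_one ht.1.le ht.2.le h

lemma tendsto_stencilCoeff (c : Stencil → Fin 7 → ℝ) (s : Stencil) :
    Tendsto (stencilCoeff c s) (𝓝[>] 0) (𝓝 (c s 0)) := by
  have hcont : Continuous (stencilCoeff c s) := by
    unfold stencilCoeff
    fun_prop
  exact (hcont.tendsto' 0 (c s 0) (by simp [stencilCoeff, Fin.sum_univ_succ])).mono_left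
    nhdsWithin_le_nhds

lemma sum_Lam_filter_snd_le_one (K : ℕ) (φ : ℕ × ℕ → ℝ) :
    ∑ r ∈ (Lam (K + 1)).filter (fun r => r.2 ≤ 1), φ r
      = ∑ m ∈ Finset.range (K + 2), φ (m, 0) + ∑ m ∈ Finset.range (K + 1), φ (m, 1) := by
  have hrows : (Lam (K + 1)).filter (fun r => r.2 ≤ 1)
      = (Finset.range (K + 2) ×ˢ {0}) ∪ (Finset.range (K + 1) ×ˢ {1}) := by
    ext r
    simp only [Finset.mem_filter, mem_Lam, Finset.mem_union, Finset.mem_product, Finset.mem_range,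
      Finset.mem_singleton]
    omega
  have hdisj : Disjoint (Finset.range (K + 2) ×ˢ ({0} : Finset ℕ)) (Finset.range (K + 1) ×ˢ {1}) :=
    Finset.disjoint_product.mpr (Or.inr (by simp))
  simp only [hrows, Finset.sum_union hdisj, Finset.sum_product, Finset.sum_singleton]

namespace InterfaceDomain

variable {D : InterfaceDomain} {k : ℕ∞} {a u f : ℝ × ℝ → ℝ} {g : ℝ → ℝ} {x₀ : ℝ} {N : ℕ}

lemma sub_taylor_stencil_isBigO (hx₀ : x₀ ∈ Ioo D.l₁ D.l₂)
    (hreg : (x₀, D.l₃) ∉ closure D.interface) (hu : ContDiffOn ℝ (N + 1 : ℕ) u D.region)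
    (s : Stencil) :
    (fun t : ℝ => u (x₀ + s.k * t, D.l₃ + s.l * t) - ∑ r ∈ Lam N,
      partialD D.region r.1 r.2 u (x₀, D.l₃) * taylorMonomial r (s.k * t) (s.l * t))
        =O[𝓝[>] 0] fun t => t ^ (N + 1) := by
  have hs : 0 ≤ s.l := Nat.cast_nonneg _
  simpa [mul_comm] using sub_taylor_isBigO D.uniqueDiffOn_region D.region_subset_closure_interior
    (eventually_mem_region hx₀ hreg (e := (s.k, s.l)) hs) N hu

lemma IsSolution.partialD_eq_sum (h : D.IsSolution k a u f g) (hk : (N : ℕ∞) ≤ k)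
    (ha : ContDiffOn ℝ (N + 1 : ℕ) a D.region) (ha₀ : ∀ z ∈ D.region, a z ≠ 0) {z : ℝ × ℝ}
    (hz : z ∈ D.region) {m n : ℕ} (hmn : m + n ≤ N + 2) :
    partialD D.region m n u z
      = ∑ r ∈ (Lam (N + 2)).filter (fun r => r.2 ≤ 1),
          partialD D.region r.1 r.2 u z * AHu D.region a z m n r.1 r.2
        + ∑ r ∈ Lam N, partialD D.region r.1 r.2 f z * AHf D.region a z m n r.1 r.2 := by
  have hu : ContDiffOn ℝ (N + 2 : ℕ) u D.region :=
    h.smooth_u.contDiffOn_nat (by exact_mod_cast add_le_add_left hk 2)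
  have hf := h.ellipticSource_eqOn (ha.of_le (by norm_cast; omega))
  rw [partialD_eq_coeffJet D.uniqueDiffOn_region D.region_subset_closure_interior ha ha₀ hu hz hmn]
  simp only [partialD_congr _ _ hf hz]
  exact forcedJet_expand _ _ hmn

lemma IsSolution.taylor_eq (h : D.IsSolution k a u f g) (hk : ((N + 1 : ℕ) : ℕ∞) ≤ k)
    (ha : ContDiffOn ℝ (N + 1 : ℕ) a D.region) (ha₀ : ∀ z ∈ D.region, a z ≠ 0)
    (hx₀ : x₀ ∈ Ioo D.l₁ D.l₂) (hreg : (x₀, D.l₃) ∉ closure D.interface) (x y : ℝ) :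
    ∑ r ∈ Lam (N + 2), partialD D.region r.1 r.2 u (x₀, D.l₃) * taylorMonomial r x y
      = ∑ n ∈ Finset.range (N + 3),
          partialD D.region n 0 u (x₀, D.l₃) * GH D.region a (x₀, D.l₃) (N + 1) n 0 x y
        - ∑ n ∈ Finset.range (N + 2),
          iteratedDeriv n g x₀ * GH D.region a (x₀, D.l₃) (N + 1) n 1 x y
        + ∑ r ∈ Lam N,
          partialD D.region r.1 r.2 f (x₀, D.l₃)
            * QH D.region a (x₀, D.l₃) (N + 1) r.1 r.2 x y := by
  have hkN : (N : ℕ∞) ≤ k := le_trans (by exact_mod_cast N.le_succ) hk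
  have hneumann (n : ℕ) (hn : n ∈ Finset.range (N + 2)) :=
    h.iteratedDeriv_neumann (m := n)
      (le_trans (by exact_mod_cast Nat.lt_succ_iff.mp (Finset.mem_range.mp hn)) hk) hx₀ hreg
  rw [Finset.sum_congr rfl fun r hr => by
      rw [h.partialD_eq_sum hkN ha ha₀ (mem_region_bottom hx₀ hreg) (mem_Lam.mp hr), add_mul,
        Finset.sum_mul, Finset.sum_mul],
    Finset.sum_add_distrib, Finset.sum_comm, Finset.sum_comm (t := Lam N)]
  simp only [mul_assoc, ← Finset.mul_sum]
  congr 1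
  · rw [Finset.sum_congr rfl fun r hr => by
        rw [← GH_eq_sum _ _ _ (Finset.mem_filter.mp hr).2 (mem_Lam.mp (Finset.mem_filter.mp hr).1)],
      sum_Lam_filter_snd_le_one, sub_eq_add_neg, ← Finset.sum_neg_distrib]
    congr 1
    exact Finset.sum_congr rfl fun n hn => by rw [hneumann n hn, neg_mul, neg_neg]
  · exact Finset.sum_congr rfl fun r hr => by
      rw [QH_eq_sum _ _ _ (Nat.add_le_add_right (mem_Lam.mp hr) 2)]

end InterfaceDomain

open InterfaceDomain in
theorem neumannScheme_hasOrder_six {D : InterfaceDomain} {a : ℝ × ℝ → ℝ}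
    (ha : ContDiffOn ℝ 5 a D.region) (ha₀ : ∀ z ∈ D.region, a z ≠ 0) {x₀ : ℝ}
    (hx₀ : x₀ ∈ Ioo D.l₁ D.l₂) (hreg : (x₀, D.l₃) ∉ closure D.interface)
    {c : Stencil → Fin 7 → ℝ} (hc : SolvesNeumannSystem D a x₀ c) :
    (neumannScheme D a x₀ c).HasOrder D a x₀ 5 4 5 6 := by
  intro u f g h
  have hcomm {ι : Type} (T : Finset ι) (A : ι → ℝ) (B : ι → Stencil → ℝ) (C : Stencil → ℝ) :
      ∑ i ∈ T, A i * ∑ s, C s * B i s = ∑ s, C s * ∑ i ∈ T, A i * B i s := by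
    simp only [Finset.mul_sum, mul_left_comm (A _)]
    exact Finset.sum_comm
  have hres (t : ℝ) : (neumannScheme D a x₀ c).residual D x₀ 4 5 u f g t
      = ∑ s : Stencil, stencilCoeff c s t * (u (x₀ + s.k * t, D.l₃ + s.l * t)
          - ∑ r ∈ Lam 6, partialD D.region r.1 r.2 u (x₀, D.l₃)
            * taylorMonomial r (s.k * t) (s.l * t))
        + ∑ n ∈ Finset.range 7, partialD D.region n 0 u (x₀, D.l₃) * ∑ s : Stencil,
          stencilCoeff c s t * GH D.region a (x₀, D.l₃) 5 n 0 (s.k * t) (s.l * t) := by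
    have htaylor := h.taylor_eq (N := 4) (by norm_num) ha ha₀ hx₀ hreg
    norm_num only at htaylor
    simp only [htaylor, SixPointScheme.residual, neumannScheme, mul_neg, Finset.sum_neg_distrib,
      hcomm]
    simp only [← Finset.sum_add_distrib, ← Finset.sum_sub_distrib, ← Finset.sum_neg_distrib]
    exact Finset.sum_congr rfl fun s _ => by ring
  refine IsBigO.congr_left ?_ fun t => (hres t).symm
  refine (IsBigO.fun_sum fun s _ => ?_).add (IsBigO.fun_sum fun n hn => ?_)
  · simpa using ((tendsto_stencilCoeff c s).isBigO_one ℝ).mul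
      (sub_taylor_stencil_isBigO hx₀ hreg (h.smooth_u.contDiffOn_nat (by norm_num)) s)
  · exact (hc n (Nat.lt_succ_iff.mp (Finset.mem_range.mp hn))).const_mul_left _

/-! ### Homogeneous parts on the stencil -/

section Slices

open Polynomial Finset.HasAntidiagonal

/-- The homogeneous part of degree `j` of the polynomial with partial derivatives `J` at the
origin, evaluated at a stencil point. -/
def slice (J : ℕ → ℕ → ℝ) (j : ℕ) (s : Stencil) : ℝ :=
  ∑ r ∈ antidiagonal j, J r.1 r.2 * taylorMonomial r s.k s.l

/-- The polynomial with partial derivatives `J` at the origin has, at `h` times a stencil point,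
the homogeneous part of degree `ν + j` equal to `h ^ (ν + j) * slice J (ν + j) s`. This is the sum
of these parts over `j ≤ B`, as a polynomial in `h` and with `h ^ ν` divided out. -/
def slicePoly (J : ℕ → ℕ → ℝ) (ν B : ℕ) (s : Stencil) : ℝ[X] :=
  ∑ j ∈ Finset.range (B + 1), C (slice J (ν + j) s) * X ^ j

variable {J J' : ℕ → ℕ → ℝ}

lemma slice_congr {j : ℕ} (h : ∀ m n, m + n = j → J m n = J' m n) : slice J j = slice J' j :=
  funext fun _ => Finset.sum_congr rfl fun _ hr => by rw [h _ _ (mem_antidiagonal.mp hr)]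

lemma coeff_slicePoly {ν B j : ℕ} (hj : j ≤ B) (s : Stencil) :
    (slicePoly J ν B s).coeff j = slice J (ν + j) s := by
  simp [slicePoly, coeff_X_pow, hj]

lemma eval_zero_slicePoly (ν B : ℕ) (s : Stencil) : (slicePoly J ν B s).eval 0 = slice J ν s := by
  rw [← coeff_zero_eq_eval_zero, coeff_slicePoly B.zero_le, add_zero]

lemma slicePoly_succ (ν B : ℕ) (s : Stencil) :
    slicePoly J ν (B + 1) s = C (slice J ν s) + X * slicePoly J (ν + 1) B s := by
  rw [slicePoly, Finset.sum_range_succ', slicePoly, Finset.mul_sum, add_comm]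
  congr 1
  · simp
  · refine Finset.sum_congr rfl fun j _ => ?_
    rw [pow_succ, add_assoc, add_comm 1 j]
    ring

lemma sum_Lam_eq_sum_antidiagonal (M : ℕ) (φ : ℕ × ℕ → ℝ) :
    ∑ r ∈ Lam M, φ r = ∑ j ∈ Finset.range (M + 1), ∑ r ∈ antidiagonal j, φ r := by
  rw [← Finset.sum_fiberwise_of_maps_to (t := Finset.range (M + 1)) (g := fun r => r.1 + r.2)
    fun r hr => Finset.mem_range_succ_iff.mpr (mem_Lam.mp hr)]
  refine Finset.sum_congr rfl fun j hj => Finset.sum_congr ?_ fun _ _ => rfl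
  rw [Finset.mem_range] at hj
  ext r
  simp only [Finset.mem_filter, mem_Lam, Finset.HasAntidiagonal.mem_antidiagonal]
  omega

lemma sum_Lam_taylorMonomial_stencil {ν : ℕ} (hJ : ∀ m n, m + n < ν → J m n = 0) (B : ℕ)
    (s : Stencil) (h : ℝ) :
    ∑ r ∈ Lam (ν + B), J r.1 r.2 * taylorMonomial r (s.k * h) (s.l * h)
      = h ^ ν * (slicePoly J ν B s).eval h := by
  have hslice (j : ℕ) : ∑ r ∈ antidiagonal j, J r.1 r.2 * taylorMonomial r (s.k * h) (s.l * h)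
      = h ^ j * slice J j s := by
    rw [slice, Finset.mul_sum]
    refine Finset.sum_congr rfl fun r hr => ?_
    rw [← mem_antidiagonal.mp hr, taylorMonomial, taylorMonomial, mul_pow, mul_pow, pow_add]
    ring
  have hlow : ∑ j ∈ Finset.range ν, h ^ j * slice J j s = 0 :=
    Finset.sum_eq_zero fun j hj => mul_eq_zero_of_right _ <| Finset.sum_eq_zero fun r hr => by
      rw [hJ _ _ ((mem_antidiagonal.mp hr).trans_lt (Finset.mem_range.mp hj)), zero_mul]
  simp only [sum_Lam_eq_sum_antidiagonal, hslice, add_assoc, Finset.sum_range_add _ ν, hlow,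
    zero_add, slicePoly, eval_finsetSum, eval_mul, eval_C, eval_pow, eval_X, Finset.mul_sum]
  exact Finset.sum_congr rfl fun j _ => by rw [pow_add]; ring

end Slices

/-- The `(m, i)`-th partial derivative at the origin of the harmonic polynomial
`Re (x + iy) ^ n / n!`, where `m + i = n`. -/
def harmonicCoeff : ℕ → ℝ
  | 0 => 1
  | 1 => 0
  | i + 2 => -harmonicCoeff i

/-- The `(m, i)`-th partial derivative, where `m + i = n + 1`, of the first correction to
`Re (x + iy) ^ n / n!` for the equation `u_yy = -u_xx - p u_x - q u_y`. -/
def correctionCoeff (p q : ℝ) : ℕ → ℝ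
  | 0 => 0
  | 1 => 0
  | i + 2 => -correctionCoeff p q i - (p * harmonicCoeff i + q * harmonicCoeff (i + 1))

/-- `Re (k + iℓ) ^ n / n!` at a stencil point. -/
def harmonicSlice (n : ℕ) : Stencil → ℝ := slice (fun _ i => harmonicCoeff i) n

/-- The first correction to `Re (k + iℓ) ^ n / n!` at a stencil point. -/
def correctionSlice (p q : ℝ) (n : ℕ) : Stencil → ℝ :=
  slice (fun _ i => correctionCoeff p q i) (n + 1)

section NeumannRows

variable {p q s : ℕ → ℕ → ℝ} {n m i : ℕ}

lemma forcedJet_single_eq_harmonicCoeff (h : m + i = n) :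
    forcedJet p q s (Pi.single (n, 0) 1) 0 i m = harmonicCoeff i := by
  induction i using Nat.twoStepInduction generalizing m with
  | zero => simp [forcedJet_zero, harmonicCoeff, ← h]
  | one => simp [forcedJet_one, harmonicCoeff]
  | more i ih _ =>
    rw [forcedJet_single_left_principal (by omega), ih (by omega), harmonicCoeff]

lemma forcedJet_single_eq_correctionCoeff (h : m + i = n + 1) :
    forcedJet p q s (Pi.single (n, 0) 1) 0 i m = correctionCoeff (p 0 0) (q 0 0) i := by
  induction i using Nat.twoStepInduction generalizing m with
  | zero =>
    rw [forcedJet_zero, correctionCoeff, Pi.single_eq_of_ne (by simp; omega)]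
  | one => simp [forcedJet_one, correctionCoeff]
  | more i ih _ =>
    rw [forcedJet_subprincipal (K := n) (fun r _ hr => single_eq_zero_of_lt r hr) (by omega),
      ih (by omega), forcedJet_single_eq_harmonicCoeff (by omega),
      forcedJet_single_eq_harmonicCoeff (by omega), correctionCoeff]

variable (S : Set (ℝ × ℝ)) (a : ℝ × ℝ → ℝ) (z₀ : ℝ × ℝ)

lemma AHu_eq_zero_of_lt (h : m + i < n) : AHu S a z₀ m i n 0 = 0 :=
  forcedJet_eq_zero_of_lt (fun r _ hr => single_eq_zero_of_lt r hr) (fun _ _ => rfl) h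

lemma slice_AHu (n : ℕ) : slice (fun m i => AHu S a z₀ m i n 0) n = harmonicSlice n :=
  slice_congr fun _ _ h => forcedJet_single_eq_harmonicCoeff h

lemma slice_AHu_succ (n : ℕ) : slice (fun m i => AHu S a z₀ m i n 0) (n + 1)
    = correctionSlice (partialX S a z₀ / a z₀) (partialY S a z₀ / a z₀) n :=
  slice_congr fun _ _ h => forcedJet_single_eq_correctionCoeff h

lemma GH_stencil_eq {M B : ℕ} (h : n + B = M + 1) (s : Stencil) (t : ℝ) :
    GH S a z₀ M n 0 (s.k * t) (s.l * t)
      = t ^ n * (slicePoly (fun m i => AHu S a z₀ m i n 0) n B s).eval t := by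
  rw [GH_eq_sum _ _ _ zero_le_one (by omega), ← h]
  exact sum_Lam_taylorMonomial_stencil (J := fun m i => AHu S a z₀ m i n 0)
    (fun _ _ => AHu_eq_zero_of_lt S a z₀) B s t

end NeumannRows

/-! ### Moments on the stencil -/

/-- The coefficients of the compact stencil for the Laplace equation at a Neumann boundary. -/
def laplaceStencil (s : Stencil) : ℝ := ![![2, 1], ![-10, 4], ![2, 1]] s.1 s.2

lemma sum_stencil (φ : Stencil → ℝ) :
    ∑ s, φ s = φ (0, 0) + φ (0, 1) + (φ (1, 0) + φ (1, 1)) + (φ (2, 0) + φ (2, 1)) := by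
  simp [Fintype.sum_prod_type, Fin.sum_univ_succ, add_assoc]

lemma slice_eq_sum_range (J : ℕ → ℕ → ℝ) (j : ℕ) (s : Stencil) :
    slice J j s = ∑ m ∈ Finset.range (j + 1),
      J m (j - m) * (s.k ^ m * s.l ^ (j - m) / (m.factorial * (j - m).factorial)) :=
  Finset.Nat.sum_antidiagonal_eq_sum_range_succ_mk ..

lemma sum_laplaceStencil_harmonicSlice {n : ℕ} (hn : n ≤ 6) :
    ∑ s, laplaceStencil s * harmonicSlice n s = 0 := by
  rw [sum_stencil]
  interval_cases n <;>
    simp [harmonicSlice, slice_eq_sum_range, Finset.sum_range_succ, harmonicCoeff, laplaceStencil,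
      Stencil.k, Stencil.l, Nat.factorial] <;>
    norm_num

lemma harmonicSlice_relation (s : Stencil) :
    2 * harmonicSlice 1 s - 30 * harmonicSlice 3 s + 360 * harmonicSlice 5 s = 0 := by
  obtain ⟨i, j⟩ := s
  fin_cases i <;> fin_cases j <;>
    simp [harmonicSlice, slice_eq_sum_range, Finset.sum_range_succ, harmonicCoeff, Stencil.k,
      Stencil.l, Nat.factorial] <;>
    norm_num

lemma harmonicSlice_six (s : Stencil) : 720 * harmonicSlice 6 s = 2 * harmonicSlice 2 s := by
  obtain ⟨i, j⟩ := s
  fin_cases i <;> fin_cases j <;>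
    simp [harmonicSlice, slice_eq_sum_range, Finset.sum_range_succ, harmonicCoeff, Stencil.k,
      Stencil.l, Nat.factorial] <;>
    norm_num

lemma sum_laplaceStencil_correctionSlice_odd (p q : ℝ) :
    ∑ s, laplaceStencil s * (2 * correctionSlice p q 1 s - 30 * correctionSlice p q 3 s
      + 360 * correctionSlice p q 5 s) = 0 := by
  rw [sum_stencil]
  simp [correctionSlice, slice_eq_sum_range, Finset.sum_range_succ, correctionCoeff, harmonicCoeff,
    laplaceStencil, Stencil.k, Stencil.l, Nat.factorial]
  ring

lemma sum_laplaceStencil_correctionSlice_even (p q : ℝ) :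
    ∑ s, laplaceStencil s * (720 * correctionSlice p q 6 s - 2 * correctionSlice p q 2 s)
      = -10 * q / 7 := by
  rw [sum_stencil]
  simp [correctionSlice, slice_eq_sum_range, Finset.sum_range_succ, correctionCoeff, harmonicCoeff,
    laplaceStencil, Stencil.k, Stencil.l, Nat.factorial]
  ring

lemma exists_stencil_harmonicSlice_eq (b : ℕ → ℝ) :
    ∃ v : Stencil → ℝ, ∀ n ≤ 4, ∑ s, v s * harmonicSlice n s = b n := by
  -- With the last weight of the middle column set to zero, the even moments determine the part
  -- symmetric in `k` and the odd ones the antisymmetric part.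
  set β := b 2 - 12 * b 4
  set δ := (b 1 - 6 * b 3) / 6 with hδ
  refine ⟨fun s => ![![b 2 - (b 1 / 2 - δ), β / 4 - δ], ![b 0 - 2 * b 2 - β / 2, 0],
    ![b 2 + (b 1 / 2 - δ), β / 4 + δ]] s.1 s.2, fun n hn => ?_⟩
  rw [sum_stencil]
  interval_cases n <;>
    simp [harmonicSlice, slice_eq_sum_range, Finset.sum_range_succ, harmonicCoeff, Stencil.k,
      Stencil.l, Nat.factorial] <;>
    linarith

lemma eq_smul_laplaceStencil {v : Stencil → ℝ} (h : ∀ n ≤ 4, ∑ s, v s * harmonicSlice n s = 0) :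
    v = v (0, 1) • laplaceStencil := by
  have h0 := h 0 (by norm_num)
  have h1 := h 1 (by norm_num)
  have h2 := h 2 (by norm_num)
  have h3 := h 3 (by norm_num)
  have h4 := h 4 (by norm_num)
  rw [sum_stencil] at h0 h1 h2 h3 h4
  simp [harmonicSlice, slice_eq_sum_range, Finset.sum_range_succ, harmonicCoeff, Stencil.k,
    Stencil.l, Nat.factorial] at h0 h1 h2 h3 h4
  ext ⟨i, j⟩
  fin_cases i <;> fin_cases j <;> simp [laplaceStencil] <;> linarith

/-! ### Solvability of the linear system -/

section Solvability

open Polynomial Finset.HasAntidiagonal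

lemma exists_stencil_harmonicSlice_eq_of_relation {b : ℕ → ℝ}
    (hb : 2 * b 1 - 30 * b 3 + 360 * b 5 = 0) :
    ∃ v : Stencil → ℝ, ∀ n ≤ 5, ∑ s, v s * harmonicSlice n s = b n := by
  obtain ⟨v, hv⟩ := exists_stencil_harmonicSlice_eq b
  refine ⟨v, fun n hn => ?_⟩
  rcases hn.lt_or_eq with hn | rfl
  · exact hv n (Nat.lt_succ_iff.mp hn)
  · have hrel : ∑ s, v s * (2 * harmonicSlice 1 s - 30 * harmonicSlice 3 s
        + 360 * harmonicSlice 5 s) = 0 :=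
      Finset.sum_eq_zero fun s _ => by rw [harmonicSlice_relation, mul_zero]
    simp only [mul_add, mul_sub, mul_left_comm (v _), Finset.sum_add_distrib,
      Finset.sum_sub_distrib, ← Finset.mul_sum, hv 1 (by norm_num), hv 3 (by norm_num)] at hrel
    linarith

variable {p q : ℝ} {ρ : ℕ → ℕ → Stencil → ℝ}

lemma exists_stencil_next_level (hρ : ∀ n, ρ n 1 = correctionSlice p q n)
    {c : ℕ → Stencil → ℝ} (hc : c 0 = laplaceStencil) (d : ℕ) :
    ∃ v : Stencil → ℝ, ∀ n, n + (d + 1) ≤ 6 →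
      ∑ s, v s * harmonicSlice n s = -∑ r ∈ antidiagonal d, ∑ s, c r.1 s * ρ n (r.2 + 1) s := by
  rcases d with _ | d
  · have hodd := sum_laplaceStencil_correctionSlice_odd p q
    simp only [mul_add, mul_sub, mul_left_comm (laplaceStencil _), Finset.sum_add_distrib,
      Finset.sum_sub_distrib, ← Finset.mul_sum] at hodd
    obtain ⟨v, hv⟩ := exists_stencil_harmonicSlice_eq_of_relation
      (b := fun n => -∑ s, laplaceStencil s * correctionSlice p q n s) (by linarith)
    exact ⟨v, fun n hn => by simpa [hc, hρ] using hv n (by omega)⟩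
  · exact (exists_stencil_harmonicSlice_eq _).imp fun v hv n hn => hv n (by omega)

lemma exists_stencil_levels (hρ₀ : ∀ n, ρ n 0 = harmonicSlice n)
    (hρ₁ : ∀ n, ρ n 1 = correctionSlice p q n) (K : ℕ) :
    ∃ c : ℕ → Stencil → ℝ, c 0 = laplaceStencil ∧ ∀ d ≤ K, ∀ n, n + d ≤ 6 →
      ∑ r ∈ antidiagonal d, ∑ s, c r.1 s * ρ n r.2 s = 0 := by
  induction K with
  | zero =>
    refine ⟨fun _ => laplaceStencil, rfl, fun d hd n hn => ?_⟩
    obtain rfl := Nat.le_zero.mp hd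
    simpa [hρ₀] using sum_laplaceStencil_harmonicSlice hn
  | succ K ih =>
    obtain ⟨c, hc₀, hc⟩ := ih
    obtain ⟨v, hv⟩ := exists_stencil_next_level hρ₁ hc₀ K
    have hold {d : ℕ} (hd : d ≤ K) {r : ℕ × ℕ} (hr : r ∈ antidiagonal d) :
        Function.update c (K + 1) v r.1 = c r.1 :=
      Function.update_of_ne (by have := mem_antidiagonal.mp hr; omega) _ _
    refine ⟨Function.update c (K + 1) v, by simp [hc₀], fun d hd n hn => ?_⟩
    rcases hd.lt_or_eq with hd | rfl
    · rw [← hc d (Nat.lt_succ_iff.mp hd) n hn]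
      exact Finset.sum_congr rfl fun r hr => by rw [hold (Nat.lt_succ_iff.mp hd) hr]
    · rw [Finset.Nat.sum_antidiagonal_succ', Function.update_self, hρ₀, hv n hn, neg_add_eq_zero]
      exact Finset.sum_congr rfl fun r hr => by rw [hold le_rfl hr]

lemma isBigO_eval_of_coeff_eq_zero {P : ℝ[X]} {n : ℕ} (hP : ∀ d < n, P.coeff d = 0) :
    (fun t => P.eval t) =O[𝓝[>] 0] fun t => t ^ n := by
  obtain ⟨Q, rfl⟩ := X_pow_dvd_iff.mpr hP
  have hQ : (fun t => Q.eval t) =O[𝓝[>] (0 : ℝ)] fun _ => (1 : ℝ) :=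
    (Q.continuous.continuousAt.tendsto.mono_left nhdsWithin_le_nhds).isBigO_one ℝ
  simpa using (isBigO_refl (fun t : ℝ => t ^ n) _).mul hQ

theorem exists_solvesNeumannSystem (D : InterfaceDomain) (a : ℝ × ℝ → ℝ) (x₀ : ℝ) :
    ∃ c : Stencil → Fin 7 → ℝ, (∃ s, c s 0 ≠ 0) ∧ SolvesNeumannSystem D a x₀ c := by
  set J : ℕ → ℕ → ℕ → ℝ := fun n m i => AHu D.region a (x₀, D.l₃) m i n 0
  obtain ⟨c, hc₀, hc⟩ := exists_stencil_levels (ρ := fun n j => slice (J n) (n + j))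
    (fun n => slice_AHu D.region a (x₀, D.l₃) n) (slice_AHu_succ D.region a (x₀, D.l₃)) 6
  refine ⟨fun s i => c i s, ⟨(0, 0), by simp [hc₀, laplaceStencil]⟩, fun n hn => ?_⟩
  set C' : Stencil → ℝ[X] := fun s => ∑ i ∈ Finset.range 7, C (c i s) * X ^ i with hC'
  have hcoeff (s : Stencil) {i : ℕ} (hi : i < 7) : (C' s).coeff i = c i s := by
    simp [hC', coeff_X_pow, hi]
  have heval (s : Stencil) (t : ℝ) : stencilCoeff (fun s i => c i s) s t = (C' s).eval t := by
    simp only [hC', stencilCoeff, eval_finsetSum, eval_mul, eval_C, eval_pow, eval_X]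
    exact Fin.sum_univ_eq_sum_range (fun i => c i s * t ^ i) 7
  have hprod : (fun t => (∑ s, C' s * slicePoly (J n) n (6 - n) s).eval t)
      =O[𝓝[>] 0] fun t => t ^ (7 - n) := by
    refine isBigO_eval_of_coeff_eq_zero fun d hd => ?_
    rw [← hc d (by omega) n (by omega), finsetSum_coeff, Finset.sum_comm]
    refine Finset.sum_congr rfl fun s _ => ?_
    rw [coeff_mul]
    refine Finset.sum_congr rfl fun r hr => ?_
    have := mem_antidiagonal.mp hr
    rw [hcoeff s (by omega), coeff_slicePoly (by omega)]
  refine ((isBigO_refl (fun t : ℝ => t ^ n) _).mul hprod).congr (fun t => ?_) fun t => ?_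
  · simp only [heval, GH_stencil_eq D.region a _ (show n + (6 - n) = 5 + 1 by omega),
      eval_finsetSum, eval_mul, Finset.mul_sum]
    exact Finset.sum_congr rfl fun s _ => by ring
  · rw [← pow_add]
    congr 1
    omega

end Solvability

/-! ### Smooth functions as exact solutions -/

section SmoothOnPlane

variable {E : Type*} [NormedAddCommGroup E] [NormedSpace ℝ E] {S : Set E} {v : E → ℝ}

lemma contDiff_dirD_univ (hv : ContDiff ℝ ∞ v) (e : E) : ContDiff ℝ ∞ (dirD univ e v) := by
  unfold dirD
  simp only [fderivWithin_univ]
  exact (hv.fderiv_right (m := ∞) (by simp)).clm_apply contDiff_const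

lemma contDiff_dirD_iterate_univ (hv : ContDiff ℝ ∞ v) (e : E) (m : ℕ) :
    ContDiff ℝ ∞ ((dirD univ e)^[m] v) := by
  induction m generalizing v with
  | zero => exact hv
  | succ _ ih => exact ih (contDiff_dirD_univ hv e)

lemma dirD_eqOn_univ (hS : UniqueDiffOn ℝ S) (hv : Differentiable ℝ v) (e : E) :
    EqOn (dirD S e v) (dirD univ e v) S := fun z hz => by
  rw [dirD, dirD, fderivWithin_univ, fderivWithin_eq_fderiv (hS z hz) (hv z)]

lemma dirD_iterate_eqOn_univ (hS : UniqueDiffOn ℝ S) (hv : ContDiff ℝ ∞ v) (e : E) (m : ℕ) :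
    EqOn ((dirD S e)^[m] v) ((dirD univ e)^[m] v) S := by
  induction m generalizing v with
  | zero => exact eqOn_refl _ _
  | succ m ih =>
    exact (dirD_iterate_congr m (dirD_eqOn_univ hS (hv.differentiable (by simp)) e)).trans
      (ih (contDiff_dirD_univ hv e))

lemma contDiff_partialD_univ {u : ℝ × ℝ → ℝ} (hu : ContDiff ℝ ∞ u) (m n : ℕ) :
    ContDiff ℝ ∞ (partialD univ m n u) :=
  contDiff_dirD_iterate_univ (contDiff_dirD_iterate_univ hu (0, 1) n) (1, 0) m

lemma partialD_eqOn_univ {S : Set (ℝ × ℝ)} (hS : UniqueDiffOn ℝ S) {u : ℝ × ℝ → ℝ}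
    (hu : ContDiff ℝ ∞ u) (m n : ℕ) : EqOn (partialD S m n u) (partialD univ m n u) S :=
  (dirD_iterate_congr m (dirD_iterate_eqOn_univ hS hu (0, 1) n)).trans
    (dirD_iterate_eqOn_univ hS (contDiff_dirD_iterate_univ hu (0, 1) n) (1, 0) m)

end SmoothOnPlane

namespace InterfaceDomain

variable {D : InterfaceDomain} {k : ℕ∞} {a u : ℝ × ℝ → ℝ}

lemma piecewiseSmooth_of_contDiff (hu : ContDiff ℝ ∞ u) (k : ℕ∞) : D.PiecewiseSmooth k u := by
  have hunif (i j : ℕ) : UniformContinuousOn (partialD D.region i j u) (D.Ω \ D.interface) :=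
    (((isCompact_Icc.prod isCompact_Icc).uniformContinuousOn_of_continuous
      (contDiff_partialD_univ hu i j).continuous.continuousOn).mono
        (D.Ω_diff_interface_subset.trans inter_subset_left)).congr
      ((partialD_eqOn_univ D.uniqueDiffOn_region hu i j).symm.mono D.Ω_diff_interface_subset)
  exact ⟨hu.contDiffOn.of_le (by exact_mod_cast le_top),
    fun i j _ => (hunif i j).mono fun z hz => ⟨hz.1, fun h => hz.2.ne' h.2⟩,
    fun i j _ => (hunif i j).mono fun z hz => ⟨hz.1, fun h => hz.2.ne h.2⟩⟩

lemma isSolution_of_contDiff (ha : ContDiffOn ℝ (k + 1) a D.region) (hu : ContDiff ℝ ∞ u) :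
    D.IsSolution k a u (ellipticSource D.region a u) fun x => -dirD univ (0, 1) u (x, D.l₃) := by
  have hS := D.uniqueDiffOn_region
  have hg : ContDiff ℝ ∞ fun x : ℝ => -dirD univ (0, 1) u (x, D.l₃) :=
    ((contDiff_dirD_univ hu (0, 1)).comp (contDiff_id.prodMk contDiff_const)).neg
  have hflux (e : ℝ × ℝ) :
      ContDiffOn ℝ k (dirD D.region e fun w => a w * dirD D.region e u w) D.region := by
    have he : ContDiffOn ℝ (k + 1) (dirD D.region e u) D.region :=
      ((contDiff_dirD_univ hu e).contDiffOn.congr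
        (dirD_eqOn_univ hS (hu.differentiable (by simp)) e)).of_le (by exact_mod_cast le_top)
    exact ((ha.mul he).fderivWithin hS le_rfl).clm_apply contDiffOn_const
  exact {
    smooth_u := piecewiseSmooth_of_contDiff hu _
    smooth_f := ((hflux (1, 0)).add (hflux (0, 1))).neg
    smooth_g := hg.contDiffOn.of_le (by exact_mod_cast le_top)
    unif_g := fun j _ => (isCompact_Icc.uniformContinuousOn_of_continuous
      (hg.continuous_iteratedDeriv j (by exact_mod_cast le_top)).continuousOn).mono
        Ioo_subset_Icc_self
    pde := fun _ _ => rfl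
    neumann := fun x hx hreg => by
      rw [← dirD_eqOn_univ hS (hu.differentiable (by simp)) (0, 1) (mem_region_bottom hx hreg),
        dirD, ← map_neg]
      simp }

end InterfaceDomain

/-! ### Upper bounds for the order -/

lemma tendsto_zero_of_tendsto_apply {α E F : Type*} [NormedAddCommGroup E] [NormedSpace ℝ E]
    [NormedAddCommGroup F] [NormedSpace ℝ F] {l : Filter α} {A : α → E →L[ℝ] F} {A₀ : E →L[ℝ] F}
    {κ : NNReal} (hA₀ : AntilipschitzWith κ A₀) (hA : Tendsto A l (𝓝 A₀)) {c : α → E}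
    (hc : Tendsto (fun t => A t (c t)) l (𝓝 0)) : Tendsto c l (𝓝 0) := by
  have hbound : c =O[l] fun t => A₀ (c t) :=
    IsBigO.of_bound κ (.of_forall fun t => A₀.bound_of_antilipschitz hA₀ (c t))
  have hsub : (fun t => (A t - A₀) (c t)) =o[l] c := by
    have hnorm : (fun t => ‖A t - A₀‖) =o[l] fun _ => (1 : ℝ) :=
      (isLittleO_one_iff ℝ).mpr (tendsto_iff_norm_sub_tendsto_zero.mp hA)
    refine (IsBigO.of_bound 1 (.of_forall fun t => ?_)).trans_isLittleO
      ((hnorm.mul_isBigO (isBigO_refl (fun t => ‖c t‖) l)).congr_right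
        fun t => one_mul _).of_norm_right
    simpa using (A t - A₀).le_opNorm (c t)
  have hA₀A : (fun t => A₀ (c t)) =O[l] fun t => A t (c t) := by
    simpa using (hsub.trans_isBigO hbound).right_isBigO_add
  exact (hbound.trans hA₀A).trans_tendsto hc

lemma tendsto_zero_of_tendsto_pairing {α ι κ : Type*} [Fintype ι] [Finite κ] {l : Filter α}
    {Φ : α → κ → ι → ℝ} {Φ₀ : κ → ι → ℝ} {c : α → ι → ℝ}
    (hΦ : ∀ k i, Tendsto (fun t => Φ t k i) l (𝓝 (Φ₀ k i)))
    (hΦ₀ : ∀ v : ι → ℝ, (∀ k, ∑ i, v i * Φ₀ k i = 0) → v = 0)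
    (hc : ∀ k, Tendsto (fun t => ∑ i, c t i * Φ t k i) l (𝓝 0)) : Tendsto c l (𝓝 0) := by
  have := Fintype.ofFinite κ
  let A (Ψ : κ → ι → ℝ) : (ι → ℝ) →L[ℝ] κ → ℝ :=
    ∑ i, (ContinuousLinearMap.proj (φ := fun _ : ι => ℝ) i).smulRight fun k => Ψ k i
  have happly (Ψ : κ → ι → ℝ) (v : ι → ℝ) (k : κ) : A Ψ v k = ∑ i, v i * Ψ k i := by
    simp [A]
  have hA : Continuous A :=
    continuous_finsetSum _ fun i _ =>
      (ContinuousLinearMap.smulRightL ℝ (ι → ℝ) (κ → ℝ) (.proj i)).continuous.comp (by fun_prop)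
  obtain ⟨K, -, hK⟩ := (A Φ₀).toLinearMap.exists_antilipschitzWith <|
    LinearMap.ker_eq_bot'.mpr fun v hv => hΦ₀ v fun k => (happly Φ₀ v k).symm.trans (congrFun hv k)
  refine tendsto_zero_of_tendsto_apply (A := fun t => A (Φ t)) hK ((hA.tendsto Φ₀).comp ?_) ?_
  · exact tendsto_pi_nhds.mpr fun k => tendsto_pi_nhds.mpr fun i => hΦ k i
  · exact tendsto_pi_nhds.mpr fun k => (hc k).congr fun t => (happly _ _ k).symm

lemma isBigO_of_pow_mul {ν n : ℕ} {G : ℝ → ℝ}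
    (h : (fun t => t ^ ν * G t) =O[𝓝[>] 0] fun t => t ^ (ν + n)) :
    G =O[𝓝[>] 0] fun t => t ^ n := by
  refine ((isBigO_refl (fun t : ℝ => (t ^ ν)⁻¹) (𝓝[>] 0)).mul h).congr' ?_ ?_ <;>
    filter_upwards [self_mem_nhdsWithin] with t (ht : 0 < t)
  · rw [inv_mul_cancel_left₀ (pow_ne_zero ν ht.ne')]
  · rw [pow_add, inv_mul_cancel_left₀ (pow_ne_zero ν ht.ne')]

lemma tendsto_zero_of_isBigO_pow {n : ℕ} (hn : n ≠ 0) {G : ℝ → ℝ}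
    (h : G =O[𝓝[>] 0] fun t => t ^ n) : Tendsto G (𝓝[>] 0) (𝓝 0) :=
  h.trans_tendsto <|
    ((continuous_pow n).tendsto' 0 0 (zero_pow hn)).mono_left nhdsWithin_le_nhds

namespace SixPointScheme

open InterfaceDomain Polynomial

variable {D : InterfaceDomain} {a : ℝ × ℝ → ℝ} {x₀ : ℝ} {σ : SixPointScheme} {k : ℕ∞}
  {N K p ν n B : ℕ}

lemma HasOrder.isBigO_slicePoly (hσ : σ.HasOrder D a x₀ k N K p) (hN : N ≤ k) (hK : K ≤ k)
    (ha : ContDiffOn ℝ (k + 1) a D.region) (ha₀ : ∀ z ∈ D.region, a z ≠ 0)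
    (hx₀ : x₀ ∈ Ioo D.l₁ D.l₂) (hreg : (x₀, D.l₃) ∉ closure D.interface) {J : ℕ → ℕ → ℝ}
    {d : ℕ × ℕ → ℝ} (hJ₀ : ∀ m i, m + i < ν → J m i = 0) (hJ₁ : ∀ m, J m 1 = 0)
    (hJ : ∀ m i, m + i ≤ N + 2 → J m i = coeffJet D.region a (x₀, D.l₃) d 0 m i)
    (hNB : N + 2 ≤ ν + B) (hKB : K + 1 ≤ ν + B) (hn : ν + n ≤ p + 1) :
    (fun h => ∑ s, σ.C s h * (slicePoly J ν B s).eval h) =O[𝓝[>] 0] fun h => h ^ n := by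
  have hS := D.uniqueDiffOn_region
  have hz := mem_region_bottom hx₀ hreg
  set u := taylorPoly (x₀, D.l₃) (ν + B) J with hu
  have hsol := isSolution_of_contDiff (u := u) ha (contDiff_taylorPoly _ _ _)
  have hf (r : ℕ × ℕ) (hr : r ∈ Lam N) :
      partialD D.region r.1 r.2 (ellipticSource D.region a u) (x₀, D.l₃) = 0 :=
    partialD_ellipticSource_eq_zero hS D.region_subset_closure_interior
      (ha.of_le (by exact_mod_cast add_le_add_left hN 1)) ha₀
      (contDiff_taylorPoly _ _ _).contDiffOn hz
      (fun m i hmi => (partialD_taylorPoly J hS hz (by omega)).trans (hJ m i hmi)) (mem_Lam.mp hr)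
  have hg (m : ℕ) (hm : m ∈ Finset.range (K + 1)) :
      iteratedDeriv m (fun x => -dirD univ (0, 1) u (x, D.l₃)) x₀ = 0 := by
    rw [Finset.mem_range_succ_iff] at hm
    rw [hsol.iteratedDeriv_neumann (le_trans (by exact_mod_cast hm) hK) hx₀ hreg,
      partialD_taylorPoly J hS hz (by omega), hJ₁, neg_zero]
  refine isBigO_of_pow_mul (ν := ν) <|
    ((hσ _ _ _ hsol).trans (pow_isBigO_pow hn)).congr_left fun h => ?_
  rw [residual, Finset.sum_eq_zero (s := Lam N) fun r hr => by rw [hf r hr, zero_mul],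
    Finset.sum_eq_zero (s := Finset.range _) fun m hm => by rw [hg m hm, zero_mul],
    add_zero, sub_zero, Finset.mul_sum]
  refine Finset.sum_congr rfl fun s _ => ?_
  simp only [hu, taylorPoly, add_sub_cancel_left, sum_Lam_taylorMonomial_stencil hJ₀ B s h]
  ring

lemma HasOrder.isBigO_slicePoly_AHu (hσ : σ.HasOrder D a x₀ k N K p) (hN : N ≤ k) (hK : K ≤ k)
    (ha : ContDiffOn ℝ (k + 1) a D.region) (ha₀ : ∀ z ∈ D.region, a z ≠ 0)
    (hx₀ : x₀ ∈ Ioo D.l₁ D.l₂) (hreg : (x₀, D.l₃) ∉ closure D.interface)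
    (hNB : N + 2 ≤ ν + B) (hKB : K + 1 ≤ ν + B) (hn : ν + n ≤ p + 1) :
    (fun h => ∑ s, σ.C s h *
      (slicePoly (fun m i => AHu D.region a (x₀, D.l₃) m i ν 0) ν B s).eval h)
        =O[𝓝[>] 0] fun h => h ^ n :=
  hσ.isBigO_slicePoly hN hK ha ha₀ hx₀ hreg (fun _ _ => AHu_eq_zero_of_lt _ _ _)
    (fun m => by simp [AHu, coeffJet, forcedJet_one]) (fun _ _ _ => rfl) hNB hKB hn

/-- The conditions `∑ C_{k,ℓ} G_{n,0} → 0` for `n ≤ 4` only leave the multiples of the Laplace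
stencil as possible limits; a further condition, not satisfied by that stencil, excludes these. -/
lemma HasOrder.not_nontrivial (hσ : σ.HasOrder D a x₀ k N K p) (hN : N ≤ k) (hK : K ≤ k)
    (ha : ContDiffOn ℝ (k + 1) a D.region) (ha₀ : ∀ z ∈ D.region, a z ≠ 0)
    (hx₀ : x₀ ∈ Ioo D.l₁ D.l₂) (hreg : (x₀, D.l₃) ∉ closure D.interface) (hp : 4 ≤ p)
    {Φ : Stencil → ℝ[X]} (hΦ : Tendsto (fun h => ∑ s, σ.C s h * (Φ s).eval h) (𝓝[>] 0) (𝓝 0))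
    (hΦ₀ : ∑ s, laplaceStencil s * (Φ s).eval 0 ≠ 0) : ¬ σ.Nontrivial := by
  let B := N + K + 2
  let row (n : ℕ) := slicePoly (fun m i => AHu D.region a (x₀, D.l₃) m i n 0) n B
  let rows (o : Option (Fin 5)) : Stencil → ℝ[X] := o.elim Φ fun n => row n
  refine not_not.mpr <| tendsto_zero_of_tendsto_pairing (Φ := fun h o s => (rows o s).eval h)
    (Φ₀ := fun o s => (rows o s).eval 0)
    (fun o s => ((rows o s).continuous.tendsto 0).mono_left nhdsWithin_le_nhds) (fun v hv => ?_) ?_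
  · have hharm (n : ℕ) (hn : n ≤ 4) : ∑ s, v s * harmonicSlice n s = 0 := by
      simpa only [rows, row, Option.elim_some, eval_zero_slicePoly, slice_AHu]
        using hv (some ⟨n, Nat.lt_succ_of_le hn⟩)
    have hlap := eq_smul_laplaceStencil hharm
    have hlast : v (0, 1) * ∑ s, laplaceStencil s * (Φ s).eval 0 = 0 := by
      have hv₀ := hv none
      rw [hlap] at hv₀
      simpa only [rows, Option.elim_none, Pi.smul_apply, smul_eq_mul, mul_assoc, ← Finset.mul_sum]
        using hv₀
    rw [hlap, (mul_eq_zero.mp hlast).resolve_right hΦ₀, zero_smul]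
  · rintro (_ | n)
    · exact hΦ
    · exact tendsto_zero_of_isBigO_pow one_ne_zero <| hσ.isBigO_slicePoly_AHu hN hK ha ha₀ hx₀ hreg
        (by omega) (by omega) (by omega)

end SixPointScheme

namespace SixPointScheme

open InterfaceDomain Polynomial

variable {D : InterfaceDomain} {a : ℝ × ℝ → ℝ} {x₀ : ℝ} {σ : SixPointScheme} {k : ℕ∞}
  {N K p : ℕ}

/-- The polynomial `(y - l₃) ^ 7 / 7!` is an exact solution all of whose data on the right-hand side
of the scheme vanish. -/
theorem HasOrder.le_six (hσ : σ.HasOrder D a x₀ k N K p) (hnt : σ.Nontrivial) (hN : N ≤ k)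
    (hK : K ≤ k) (hN₄ : N ≤ 4) (hK₆ : K ≤ 6) (ha : ContDiffOn ℝ (k + 1) a D.region)
    (ha₀ : ∀ z ∈ D.region, a z ≠ 0) (hx₀ : x₀ ∈ Ioo D.l₁ D.l₂)
    (hreg : (x₀, D.l₃) ∉ closure D.interface) : p ≤ 6 := by
  by_contra! hp
  let J (m n : ℕ) : ℝ := if (m, n) = (0, 7) then 1 else 0
  have hJ {m n : ℕ} (h : n ≠ 7) : J m n = 0 := if_neg fun h' => h (Prod.ext_iff.mp h').2
  have hslice (s : Stencil) : slice J 7 s = s.l ^ 7 / 5040 := by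
    simp [slice, J, Finset.Nat.sum_antidiagonal_eq_sum_range_succ_mk, Finset.sum_range_succ,
      taylorMonomial, Nat.factorial]
  have hdata {m n : ℕ} (h : m + n ≤ N + 2) : J m n = coeffJet D.region a (x₀, D.l₃) 0 0 m n := by
    rw [hJ (by omega)]
    exact (forcedJet_eq_zero_of_lt (K := m + n + 1) (fun _ _ _ => rfl) (fun _ _ => rfl)
      (Nat.lt_succ_self _)).symm
  have hsum := hσ.isBigO_slicePoly (ν := 7) (B := 0) (n := 1) hN hK ha ha₀ hx₀ hreg
    (fun m n h => hJ (by omega)) (fun m => hJ (by norm_num)) (fun m n => hdata) (by omega)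
    (by omega) (by omega)
  refine hσ.not_nontrivial hN hK ha ha₀ hx₀ hreg (by omega)
    (tendsto_zero_of_isBigO_pow one_ne_zero hsum) ?_ hnt
  simp only [eval_zero_slicePoly, hslice]
  have hsum : ∑ s : Stencil, laplaceStencil s * (s.l ^ 7 / 5040) = 1 / 840 := by
    simp [sum_stencil, laplaceStencil, Stencil.l]
    norm_num
  rw [hsum]
  norm_num

/-- On the stencil `720 G_{6,0}` and `2 G_{2,0}` agree to leading order in `h`, so that their
difference divided by `h` is a condition on the limit. -/
theorem HasOrder.le_six_of_partialY_ne_zero (hσ : σ.HasOrder D a x₀ k N K p)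
    (hnt : σ.Nontrivial) (hN : N ≤ k) (hK : K ≤ k) (ha : ContDiffOn ℝ (k + 1) a D.region)
    (ha₀ : ∀ z ∈ D.region, a z ≠ 0) (hx₀ : x₀ ∈ Ioo D.l₁ D.l₂)
    (hreg : (x₀, D.l₃) ∉ closure D.interface) (hy : partialY D.region a (x₀, D.l₃) ≠ 0) :
    p ≤ 6 := by
  by_contra! hp
  let B := N + K + 2
  let A (ν m i : ℕ) : ℝ := AHu D.region a (x₀, D.l₃) m i ν 0
  let Φ (s : Stencil) : ℝ[X] :=
    720 * slicePoly (A 6) 7 B s - 2 * slicePoly (A 2) 3 B s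
  have hrow {ν : ℕ} (hν : ν + 2 ≤ p + 1) := hσ.isBigO_slicePoly_AHu (ν := ν) (B := B + 1) (n := 2)
    hN hK ha ha₀ hx₀ hreg (by omega) (by omega) hν
  have hcancel (s : Stencil) :
      720 * slicePoly (A 6) 6 (B + 1) s - 2 * slicePoly (A 2) 2 (B + 1) s = X * Φ s := by
    have hlead : 720 * Polynomial.C (slice (A 6) 6 s) = 2 * Polynomial.C (slice (A 2) 2 s) := by
      simpa only [slice_AHu, A, map_mul, map_ofNat]
        using congrArg Polynomial.C (harmonicSlice_six s)
    simp only [slicePoly_succ, Φ]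
    linear_combination hlead
  have hsum : (fun h => ∑ s, σ.C s h * (Φ s).eval h) =O[𝓝[>] 0] fun h => h ^ 1 := by
    refine isBigO_of_pow_mul (ν := 1) <| (((hrow (ν := 6) (by omega)).const_mul_left 720).sub
      ((hrow (ν := 2) (by omega)).const_mul_left 2)).congr_left fun h => ?_
    rw [Finset.mul_sum, Finset.mul_sum, Finset.mul_sum, ← Finset.sum_sub_distrib]
    refine Finset.sum_congr rfl fun s _ => ?_
    have := congrArg (eval h) (hcancel s)
    simp only [eval_sub, eval_mul, eval_X, eval_ofNat] at this
    linear_combination σ.C s h * this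
  refine hσ.not_nontrivial hN hK ha ha₀ hx₀ hreg (by omega)
    (tendsto_zero_of_isBigO_pow one_ne_zero hsum) ?_ hnt
  have hz := mem_region_bottom hx₀ hreg
  simp only [Φ, eval_sub, eval_mul, eval_ofNat, eval_zero_slicePoly, A, slice_AHu_succ _ _ _ 6,
    slice_AHu_succ _ _ _ 2, sum_laplaceStencil_correctionSlice_even]
  have hq := div_ne_zero hy (ha₀ _ hz)
  exact div_ne_zero (mul_ne_zero (by norm_num) hq) (by norm_num)

end SixPointScheme

lemma neumannScheme_nontrivial {D : InterfaceDomain} {a : ℝ × ℝ → ℝ} {x₀ : ℝ}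
    {c : Stencil → Fin 7 → ℝ} (hc : ∃ s, c s 0 ≠ 0) : (neumannScheme D a x₀ c).Nontrivial := by
  obtain ⟨s, hs⟩ := hc
  exact fun h => hs (tendsto_nhds_unique (tendsto_stencilCoeff c s) (tendsto_pi_nhds.mp h s))

theorem theorem2p3_general (D : InterfaceDomain) (a : ℝ × ℝ → ℝ) (ha : ContDiffOn ℝ 6 a D.region)
    (ha₀ : ∀ z ∈ D.region, a z ≠ 0) (x₀ : ℝ) (hx₀ : x₀ ∈ Ioo D.l₁ D.l₂)
    (hreg : (x₀, D.l₃) ∉ closure D.interface) :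
    (∀ c : Stencil → Fin 7 → ℝ, SolvesNeumannSystem D a x₀ c →
      (neumannScheme D a x₀ c).HasOrder D a x₀ 5 4 5 6) ∧
    (∃ c : Stencil → Fin 7 → ℝ, (∃ s, c s 0 ≠ 0) ∧ SolvesNeumannSystem D a x₀ c) ∧
    IsGreatest {p : ℕ | ∃ σ : SixPointScheme, σ.Nontrivial ∧ σ.HasOrder D a x₀ 5 4 5 p} 6 ∧
    (∀ k : ℕ∞, ContDiffOn ℝ (k + 1) a D.region → partialY D.region a (x₀, D.l₃) ≠ 0 →
      ∀ (N K p : ℕ) (σ : SixPointScheme), N ≤ k → K ≤ k → σ.Nontrivial →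
        σ.HasOrder D a x₀ k N K p → p ≤ 6) := by
  have horder (c : Stencil → Fin 7 → ℝ) (hc : SolvesNeumannSystem D a x₀ c) :
      (neumannScheme D a x₀ c).HasOrder D a x₀ 5 4 5 6 :=
    neumannScheme_hasOrder_six (ha.of_le (by norm_num)) ha₀ hx₀ hreg hc
  obtain ⟨c, hc₀, hc⟩ := exists_solvesNeumannSystem D a x₀
  refine ⟨horder, ⟨c, hc₀, hc⟩, ⟨⟨_, neumannScheme_nontrivial hc₀, horder c hc⟩, ?_⟩, ?_⟩
  · rintro p ⟨σ, hnt, hσ⟩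
    exact hσ.le_six hnt (by norm_num) (by norm_num) (by norm_num) (by norm_num)
      (by norm_num; exact ha) ha₀ hx₀ hreg
  · exact fun k hak hy N K p σ hN hK hnt hσ =>
      hσ.le_six_of_partialY_ne_zero hnt hN hK hak ha₀ hx₀ hreg hy

end

theorem theorem2p3 (D : InterfaceDomain) (a : ℝ × ℝ → ℝ)
    (ha : D.PiecewiseSmooth 6 a) (ha_pos : ∀ z ∈ D.region, 0 < a z)
    (x₀ : ℝ) (hx₀ : x₀ ∈ Ioo D.l₁ D.l₂) (hreg : (x₀, D.l₃) ∉ closure D.interface) :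
    -- every nontrivial solution of the linear system gives a scheme of order six
    (∀ c : Stencil → Fin 7 → ℝ, c ≠ 0 → SolvesNeumannSystem D a x₀ c →
      (neumannScheme D a x₀ c).HasOrder D a x₀ 5 4 5 6) ∧
    -- there are solutions whose leading coefficients do not all vanish
    (∃ c : Stencil → Fin 7 → ℝ, (∃ s, c s 0 ≠ 0) ∧ SolvesNeumannSystem D a x₀ c) ∧
    -- six is the maximum order of six-point schemes with the same data on the right-hand side
    IsGreatest {p : ℕ | ∃ σ : SixPointScheme, σ.Nontrivial ∧ σ.HasOrder D a x₀ 5 4 5 p} 6 ∧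
    -- for a smooth coefficient with nonzero normal derivative at the point, derivatives of the
    -- data of higher order do not help
    (D.PiecewiseSmooth ⊤ a → partialY D.region a (x₀, D.l₃) ≠ 0 →
      ∀ (N K p : ℕ) (σ : SixPointScheme), σ.Nontrivial → σ.HasOrder D a x₀ ⊤ N K p → p ≤ 6) := by
  obtain ⟨horder, hsolvable, hgreatest, hsmooth⟩ :=
    theorem2p3_general D a ha.contDiffOn (fun z hz => (ha_pos z hz).ne') x₀ hx₀ hreg
  exact ⟨fun c _ => horder c, hsolvable, hgreatest, fun ha' hy N K p σ =>
    hsmooth ⊤ ha'.contDiffOn hy N K p σ le_top le_top⟩
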